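/- Let $X$ be a proper CAT(0) space and let $g : X \to X$ be a (surjective) isometry. For $A\subseteq X$ and $x\in X$ let $\pi_A(x)$ be the set of points of $A$ that minimize the distance to $x$, and for $K \subseteq X$ put $\pi_A(K)=\bigcup_{x\in K}\pi_A(x)$. For $B>0$, a geodesic segment or geodesic line $A\subseteq X$ is called $B$-contracting if $\operatorname{diam}\pi_A(K)<B$ for every metric ball $K$ disjoint from $A$. The isometry $g$ is hyperbolic if $x\mapsto d(x,g x)$ attains a positive minimum; an axis of $g$ is a geodesic line on which $g$ acts as a nontrivial translation. A geodesic line $\ell$ bounds a half-flat if there is an isometric embedding of the closed Euclidean half-plane $\mathbb{R}\times[0,\infty)$ into $X$ that maps $\mathbb{R}\times\{0\}$ onto $\ell$. 1. If $g$ is hyperbolic and $\ell$ is an axis of $g$, then $\ell$ is $B$-contracting for some $B>0$ if and only if $\ell$ does not bound a half-flat. 2. Consequently the following two notions of rank 1 agree for every isometry $g$ of $X$. (a) For a basepoint $x_0\in X$ and $x_n=g^n(x_0)$: $d(x_n,x_0)\to\infty$ as $n\to\infty$, and there is $B>0$ such that for every $n>0$ some geodesic $[x_0,x_n]$ and the set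 $\{x_0,x_1,\dots,x_n\}$ are each contained in the $B$-neighbourhood of the other, and some geodesic $[x_0,x_n]$ is $B$-contracting. (b) (Ballmann–Brin) $g$ is hyperbolic and some axis of $g$ (equivalently, every axis of $g$) does not bound a half-flat. That is, the two forms of (b) are equivalent, and for every choice of basepoint $x_0\in X$, (a) holds if and only if (b) holds. -/

import Mathlib

/-- `S` is (the image of) a geodesic segment from `x` to `y`. -/
def IsGeodesicSegment {X : Type*} [MetricSpace X] (x y : X) (S : Set X) : Prop :=
  ∃ γ : ℝ → X, γ 0 = x ∧ γ (dist x y) = y ∧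
    (∀ s ∈ Set.Icc 0 (dist x y), ∀ t ∈ Set.Icc 0 (dist x y), dist (γ s) (γ t) = |s - t|) ∧
    γ '' Set.Icc 0 (dist x y) = S

/-- A CAT(0) space: a geodesic metric space all of whose geodesic triangles are at least as thin
as their comparison triangles in the Euclidean plane.

Two points on a triangle either lie on a common side (where the comparison is an equality) or on
two sides that share a vertex; the shared vertex is called `x` below. -/
structure IsCATZero (X : Type*) [MetricSpace X] : Prop where
  exists_geodesic : ∀ x y : X, ∃ S : Set X, IsGeodesicSegment x y S
  comparison : ∀ (x y z : X) (S T : Set X),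
    IsGeodesicSegment x y S → IsGeodesicSegment x z T →
    ∀ x' y' z' : EuclideanSpace ℝ (Fin 2),
      dist x' y' = dist x y → dist x' z' = dist x z → dist y' z' = dist y z →
    ∀ p ∈ S, ∀ q ∈ T, ∀ p' ∈ segment ℝ x' y', ∀ q' ∈ segment ℝ x' z',
      dist x' p' = dist x p → dist x' q' = dist x q →
      dist p q ≤ dist p' q'

/-- The set of points of `A` that minimize the distance to `x`
(the multivalued nearest-point projection). -/
def nearestPoints {X : Type*} [MetricSpace X] (A : Set X) (x : X) : Set X :=
  {p | p ∈ A ∧ ∀ q ∈ A, dist x p ≤ dist x q}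

/-- An open or closed metric ball. -/
def IsMetricBall {X : Type*} [MetricSpace X] (K : Set X) : Prop :=
  ∃ (z : X) (r : ℝ), K = Metric.ball z r ∨ K = Metric.closedBall z r

/-- `A` (a geodesic segment or a geodesic line) is `B`-contracting: the projection to `A` of every
metric ball disjoint from `A` has diameter less than `B`. The diameter is taken in `[0, ∞]`, so
that an unbounded projection does not qualify. -/
def IsContracting {X : Type*} [MetricSpace X] (B : ℝ) (A : Set X) : Prop :=
  ∀ K : Set X, IsMetricBall K → Disjoint K A →
    Metric.ediam (⋃ x ∈ K, nearestPoints A x) < ENNReal.ofReal B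

/-- A hyperbolic isometry: the displacement `x ↦ d(x, g x)` attains a positive minimum. -/
def IsHyperbolicIsometry {X : Type*} [MetricSpace X] (g : X ≃ᵢ X) : Prop :=
  ∃ x : X, 0 < dist x (g x) ∧ ∀ y : X, dist x (g x) ≤ dist y (g y)

/-- An axis of `g`: a geodesic line along which `g` acts as a nontrivial translation. -/
def IsAxis {X : Type*} [MetricSpace X] (g : X ≃ᵢ X) (l : Set X) : Prop :=
  ∃ (c : ℝ → X) (τ : ℝ), Isometry c ∧ Set.range c = l ∧ 0 < τ ∧ ∀ t : ℝ, g (c t) = c (t + τ)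

/-- The closed Euclidean upper half-plane. -/
def euclideanHalfPlane : Set (EuclideanSpace ℝ (Fin 2)) :=
  {p | 0 ≤ p 1}

/-- `l` bounds a half-flat (flat half-plane): there is an isometric embedding of the closed
Euclidean half-plane that takes the boundary line onto `l`. -/
def BoundsHalfFlat {X : Type*} [MetricSpace X] (l : Set X) : Prop :=
  ∃ f : euclideanHalfPlane → X, Isometry f ∧ f '' {p | (p : EuclideanSpace ℝ (Fin 2)) 1 = 0} = l

/-- Each of the two sets lies in the `B`-neighbourhood of the other. -/
def HausdorffEquivalent {X : Type*} [MetricSpace X] (B : ℝ) (S T : Set X) : Prop :=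
  S ⊆ Metric.thickening B T ∧ T ⊆ Metric.thickening B S

/-- Rank 1 in the sense of contracting orbit segments, with respect to the basepoint `x₀`. -/
def IsRankOne {X : Type*} [MetricSpace X] (g : X ≃ᵢ X) (x₀ : X) : Prop :=
  Filter.Tendsto (fun n : ℕ => dist (g^[n] x₀) x₀) Filter.atTop Filter.atTop ∧
    ∃ B : ℝ, 0 < B ∧ ∀ n : ℕ, 0 < n →
      (∃ S : Set X, IsGeodesicSegment x₀ (g^[n] x₀) S ∧
        HausdorffEquivalent B S {y | ∃ k ≤ n, y = g^[k] x₀}) ∧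
      (∃ S : Set X, IsGeodesicSegment x₀ (g^[n] x₀) S ∧ IsContracting B S)

/-- Rank 1 in the sense of Ballmann and Brin: `g` is hyperbolic and some axis of `g` does not
bound a half-flat. -/
def IsBallmannBrinRankOne {X : Type*} [MetricSpace X] (g : X ≃ᵢ X) : Prop :=
  IsHyperbolicIsometry g ∧ ∃ l : Set X, IsAxis g l ∧ ¬ BoundsHalfFlat l

open Filter Topology

/-! A half-flat makes balls beside its boundary line project onto long pieces of that line, so the
depth of part 1 lies in the converse. Let `z` have its nearest point at the start of a geodesic that
follows an axis `ℓ`. The distance to `z` is convex along this geodesic, with slopes in [0, 1]. If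
slopes below 31/32 occurred arbitrarily late, there would be long stretches of almost constant
slope. Translating these back to `ℓ 0` by powers of `g` and passing to an ultralimit gives a
Busemann function that is affine along `ℓ` with slope of absolute value less than 1, and the rays
towards its centre sweep out a half-flat (`boundsHalfFlat_of_tendsto`). Without half-flats the slope
is therefore at least 31/32 after a uniform time (`exists_slope_bound`). If `z` and `x` project to
distant points, their triangle with the point midway between the projections is obtuse there, so `x`
is farther from `z` than the geodesic is, and no ball about `z` disjoint from the geodesic contains
`x` (`exists_uniform_contracting`).

The bound is uniform over geodesics near `ℓ`, which gives (a) from (b). Conversely, the orbit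
condition in (a) provides a closed, midpoint-closed invariant set on which `g` acts cocompactly; the
displacement attains a positive minimum there, and this produces an axis
(`IsCATZero.exists_isAxis`). A half-flat along it would spoil the contraction of long orbit
segments. Different axes stay at bounded distance, so the Busemann argument also carries half-flats
from one axis to another. -/

/-- `p` divides a geodesic from `x` to `y` in the ratio `r : 1 - r`. -/
def IsBetween {X : Type*} [MetricSpace X] (x y : X) (r : ℝ) (p : X) : Prop :=
  dist x p = r * dist x y ∧ dist p y = (1 - r) * dist x y

/-! ### CAT(0) comparison in terms of side lengths -/

section CATZero

variable {X : Type*} [MetricSpace X]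

theorem IsBetween.symm {x y p : X} {r : ℝ} (h : IsBetween x y r p) :
    IsBetween y x (1 - r) p :=
  ⟨by rw [dist_comm y p, dist_comm y x, h.2], by rw [dist_comm p x, dist_comm y x, h.1]; ring⟩

theorem IsBetween.right (x y : X) : IsBetween x y 1 y := by simp [IsBetween]

theorem IsBetween.map {x y p : X} {r : ℝ} (h : IsBetween x y r p) {f : X → X} (hf : Isometry f) :
    IsBetween (f x) (f y) r (f p) := by
  simpa [IsBetween, hf.dist_eq] using h

theorem isBetween_of_isometricOn {c : ℝ → X} {a b : ℝ} (hab : a ≤ b)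
    (hc : ∀ s ∈ Set.Icc a b, ∀ t ∈ Set.Icc a b, dist (c s) (c t) = |s - t|) {r : ℝ}
    (h0 : 0 ≤ r) (h1 : r ≤ 1) : IsBetween (c a) (c b) r (c (a + r * (b - a))) := by
  have hm : a + r * (b - a) ∈ Set.Icc a b := ⟨by nlinarith, by nlinarith⟩
  have ha : a ∈ Set.Icc a b := ⟨le_rfl, hab⟩
  have hb : b ∈ Set.Icc a b := ⟨hab, le_rfl⟩
  refine ⟨?_, ?_⟩
  · rw [hc a ha _ hm, hc a ha b hb, abs_of_nonpos (by nlinarith), abs_of_nonpos (by linarith)]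
    ring
  · rw [hc _ hm b hb, hc a ha b hb, abs_of_nonpos (by nlinarith), abs_of_nonpos (by linarith)]
    ring

theorem IsGeodesicSegment.exists_isBetween {x y : X} {S : Set X} (hS : IsGeodesicSegment x y S)
    {r : ℝ} (h0 : 0 ≤ r) (h1 : r ≤ 1) : ∃ p ∈ S, IsBetween x y r p := by
  obtain ⟨γ, hx, hy, hγ, rfl⟩ := hS
  have hm : r * dist x y ∈ Set.Icc 0 (dist x y) :=
    ⟨by positivity, mul_le_of_le_one_left dist_nonneg h1⟩
  refine ⟨γ (r * dist x y), ⟨_, hm, rfl⟩, ?_⟩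
  have := isBetween_of_isometricOn dist_nonneg hγ h0 h1
  rwa [hx, hy, sub_zero, zero_add] at this

/-- Euclidean comparison triangles exist. -/
theorem exists_comparison_triangle {a b c : ℝ} (ha : 0 ≤ a) (hb : 0 ≤ b) (hc : 0 ≤ c)
    (h1 : a ≤ b + c) (h2 : b ≤ a + c) (h3 : c ≤ a + b) :
    ∃ y z : EuclideanSpace ℝ (Fin 2), ‖y‖ = a ∧ ‖z‖ = b ∧ ‖y - z‖ = c := by
  rcases ha.eq_or_lt with rfl | ha
  · refine ⟨0, !₂[b, 0], by simp, ?_, ?_⟩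
    · simp [EuclideanSpace.norm_eq, Real.sqrt_sq hb]
    · rw [zero_sub, norm_neg]
      simp [EuclideanSpace.norm_eq, Real.sqrt_sq hb]
      linarith
  -- With `y` on the first coordinate axis, `u` is the first coordinate of `z` by the law of
  -- cosines. Heron's factorization shows that the second one is real.
  set u := (a ^ 2 + b ^ 2 - c ^ 2) / (2 * a) with hu
  have hua : u * (2 * a) = a ^ 2 + b ^ 2 - c ^ 2 := by rw [hu]; field_simp
  have hub : 0 ≤ b ^ 2 - u ^ 2 := by
    have : 0 ≤ (b ^ 2 - u ^ 2) * (2 * a) ^ 2 := by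
      have : (b ^ 2 - u ^ 2) * (2 * a) ^ 2 =
          ((a + b - c) * (a + b + c)) * ((c + a - b) * (c - a + b)) := by
        have : (b ^ 2 - u ^ 2) * (2 * a) ^ 2 = b ^ 2 * (2 * a) ^ 2 - (u * (2 * a)) ^ 2 := by ring
        rw [this, hua]; ring
      rw [this]
      have e1 : 0 ≤ a + b - c := by linarith
      have e2 : 0 ≤ c + a - b := by linarith
      have e3 : 0 ≤ c - a + b := by linarith
      positivity
    exact nonneg_of_mul_nonneg_left this (by positivity)
  refine ⟨!₂[a, 0], !₂[u, √(b ^ 2 - u ^ 2)], ?_, ?_, ?_⟩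
  · simp [EuclideanSpace.norm_eq, Real.sqrt_sq ha.le]
  · simp [EuclideanSpace.norm_eq, Real.sq_sqrt hub, Real.sqrt_sq hb]
  · simp only [EuclideanSpace.norm_eq, Fin.sum_univ_two, Real.norm_eq_abs, sq_abs, PiLp.sub_apply]
    simp [Real.sq_sqrt hub]
    rw [show (a - u) ^ 2 + (b ^ 2 - u ^ 2) = c ^ 2 by nlinarith, Real.sqrt_sq hc]

theorem IsCATZero.comparison_sq_of_mem (hX : IsCATZero X) {x y z : X} {S T : Set X}
    (hS : IsGeodesicSegment x y S) (hT : IsGeodesicSegment x z T) {r s : ℝ} (hr0 : 0 ≤ r)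
    (hr1 : r ≤ 1) (hs0 : 0 ≤ s) (hs1 : s ≤ 1) {p q : X} (hp : p ∈ S) (hq : q ∈ T)
    (hpr : dist x p = r * dist x y) (hqs : dist x q = s * dist x z) :
    dist p q ^ 2 ≤ r ^ 2 * dist x y ^ 2 + s ^ 2 * dist x z ^ 2
      - r * s * (dist x y ^ 2 + dist x z ^ 2 - dist y z ^ 2) := by
  obtain ⟨y', z', hy, hz, hyz⟩ := exists_comparison_triangle (a := dist x y) (b := dist x z)
    (c := dist y z) dist_nonneg dist_nonneg dist_nonneg
    (by linarith [dist_triangle x z y, dist_comm y z])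
    (by linarith [dist_triangle x y z])
    (by linarith [dist_triangle y x z, dist_comm x y])
  have key := hX.comparison x y z S T hS hT 0 y' z' (by rw [dist_zero_left, hy])
    (by rw [dist_zero_left, hz]) (by rw [dist_eq_norm, hyz]) p hp q hq (r • y')
    ⟨1 - r, r, by linarith, hr0, by ring, by simp⟩ (s • z')
    ⟨1 - s, s, by linarith, hs0, by ring, by simp⟩
    (by rw [dist_zero_left, norm_smul, Real.norm_of_nonneg hr0, hy, hpr])
    (by rw [dist_zero_left, norm_smul, Real.norm_of_nonneg hs0, hz, hqs])
  have h1 : dist p q ^ 2 ≤ ‖r • y' - s • z'‖ ^ 2 := by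
    rw [← dist_eq_norm]; exact pow_le_pow_left₀ dist_nonneg key 2
  have h2 := norm_sub_sq_real y' z'
  have h3 := norm_sub_sq_real (r • y') (s • z')
  rw [hy, hz, hyz] at h2
  rw [inner_smul_left, inner_smul_right, norm_smul, norm_smul, Real.norm_of_nonneg hr0,
    Real.norm_of_nonneg hs0, hy, hz] at h3
  simp only [conj_trivial] at h3
  refine h1.trans_eq ?_
  rw [h3, h2]
  ring

theorem IsCATZero.exists_isBetween (hX : IsCATZero X) (x y : X) {r : ℝ} (h0 : 0 ≤ r)
    (h1 : r ≤ 1) : ∃ p, IsBetween x y r p := by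
  obtain ⟨S, hS⟩ := hX.exists_geodesic x y
  obtain ⟨p, -, hp⟩ := hS.exists_isBetween h0 h1
  exact ⟨p, hp⟩

/-- A point dividing a pair in a given ratio lies on every geodesic segment joining the pair. -/
theorem IsCATZero.mem_of_isBetween (hX : IsCATZero X) {x y p : X} {S : Set X} {r : ℝ}
    (h0 : 0 ≤ r) (h1 : r ≤ 1) (hS : IsGeodesicSegment x y S) (hp : IsBetween x y r p) :
    p ∈ S := by
  obtain ⟨q, hqS, hq⟩ := hS.exists_isBetween h0 h1
  obtain ⟨T, hT⟩ := hX.exists_geodesic x p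
  have hpT : p ∈ T := by
    obtain ⟨γ, -, hy, -, rfl⟩ := hT
    exact ⟨_, ⟨dist_nonneg, le_rfl⟩, hy⟩
  -- The comparison triangle for `x`, `y`, `p` is degenerate, and the right-hand side vanishes.
  have key := hX.comparison_sq_of_mem hS hT h0 h1 zero_le_one le_rfl hqS hpT hq.1 (by ring)
  rw [dist_comm y p, hp.1, hp.2] at key
  have : dist q p ^ 2 ≤ 0 := by nlinarith
  have : dist q p = 0 := by nlinarith [dist_nonneg (x := q) (y := p)]
  rwa [← dist_eq_zero.1 this]

/-- The CAT(0) comparison of two points on two sides of a triangle, in terms of side lengths. -/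
theorem IsCATZero.comparison_sq (hX : IsCATZero X) {x y z p q : X} {r s : ℝ} (hr0 : 0 ≤ r)
    (hr1 : r ≤ 1) (hs0 : 0 ≤ s) (hs1 : s ≤ 1) (hp : IsBetween x y r p) (hq : IsBetween x z s q) :
    dist p q ^ 2 ≤ r ^ 2 * dist x y ^ 2 + s ^ 2 * dist x z ^ 2
      - r * s * (dist x y ^ 2 + dist x z ^ 2 - dist y z ^ 2) := by
  obtain ⟨S, hS⟩ := hX.exists_geodesic x y
  obtain ⟨T, hT⟩ := hX.exists_geodesic x z
  exact hX.comparison_sq_of_mem hS hT hr0 hr1 hs0 hs1 (hX.mem_of_isBetween hr0 hr1 hS hp)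
    (hX.mem_of_isBetween hs0 hs1 hT hq) hp.1 hq.1

/-- Comparison at the vertex `y`, where the second point is the far end `x` of its side. -/
theorem IsCATZero.stewart (hX : IsCATZero X) {y z m : X} {r : ℝ} (h0 : 0 ≤ r) (h1 : r ≤ 1)
    (hm : IsBetween y z r m) (x : X) :
    dist x m ^ 2 ≤ (1 - r) * dist x y ^ 2 + r * dist x z ^ 2 - r * (1 - r) * dist y z ^ 2 := by
  have := hX.comparison_sq h0 h1 zero_le_one le_rfl hm (IsBetween.right y x)
  rw [dist_comm m x, dist_comm y x, dist_comm z x] at this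
  linarith

/-- The square of the right-hand side exceeds the Stewart bound by `r * (1 - r)` times `dist y z ^ 2
- (dist x y - dist x z) ^ 2`, which is nonnegative. -/
theorem IsCATZero.dist_convex (hX : IsCATZero X) {y z m : X} {r : ℝ} (h0 : 0 ≤ r) (h1 : r ≤ 1)
    (hm : IsBetween y z r m) (x : X) :
    dist x m ≤ (1 - r) * dist x y + r * dist x z := by
  have h := hX.stewart h0 h1 hm x
  have e : 0 ≤ r * (1 - r) := mul_nonneg h0 (by linarith)
  have tri : (dist x y - dist x z) ^ 2 ≤ dist y z ^ 2 :=
    sq_le_sq.2 (by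
      rw [abs_of_nonneg (dist_nonneg (x := y)), abs_le]
      constructor <;> linarith [dist_triangle x y z, dist_triangle x z y, dist_comm y z])
  refine le_of_sq_le_sq ?_ (by have : 0 ≤ 1 - r := by linarith
                               positivity)
  nlinarith [mul_le_mul_of_nonneg_left tri e]

theorem IsCATZero.dist_le_of_common_vertex (hX : IsCATZero X) {x y z p q : X} {r : ℝ} (h0 : 0 ≤ r)
    (h1 : r ≤ 1) (hp : IsBetween x y r p) (hq : IsBetween x z r q) :
    dist p q ≤ r * dist y z := by
  have := hX.comparison_sq h0 h1 h0 h1 hp hq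
  refine le_of_sq_le_sq ?_ (by positivity)
  nlinarith

/-- The diagonal from `x` to `y'` splits the quadrilateral into two triangles with a common vertex.
-/
theorem IsCATZero.dist_quadrilateral (hX : IsCATZero X) {x y x' y' p q : X} {r : ℝ} (h0 : 0 ≤ r)
    (h1 : r ≤ 1) (hp : IsBetween x y r p) (hq : IsBetween x' y' r q) :
    dist p q ≤ (1 - r) * dist x x' + r * dist y y' := by
  obtain ⟨m, hm⟩ := hX.exists_isBetween x y' h0 h1
  have e1 := hX.dist_le_of_common_vertex h0 h1 hp hm
  have e2 := hX.dist_le_of_common_vertex (by linarith) (by linarith) hm.symm hq.symm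
  linarith [dist_triangle p m q]

/-- Distance to a fixed point is convex along a path that is isometric on an interval. -/
theorem IsCATZero.convexOn_dist (hX : IsCATZero X) {c : ℝ → X} {I : Set ℝ} (hI : Convex ℝ I)
    (hc : ∀ s ∈ I, ∀ t ∈ I, dist (c s) (c t) = |s - t|) (x : X) :
    ConvexOn ℝ I (fun t => dist x (c t)) := by
  refine LinearOrder.convexOn_of_lt hI ?_
  intro a ha b hb hab p q hp hq hpq
  have hsub : Set.Icc a b ⊆ I := hI.ordConnected.out ha hb
  have := hX.dist_convex hq.le (by linarith) (isBetween_of_isometricOn hab.le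
    (fun s hs t ht => hc s (hsub hs) t (hsub ht)) hq.le (by linarith)) x
  have e : a + q * (b - a) = p * a + q * b := by
    rw [show p = 1 - q by linarith]; ring
  rw [e, show 1 - q = p by linarith] at this
  simpa using this

end CATZero

/-! ### Half-flats from affine Busemann functions -/

section HalfFlat

variable {X : Type*} [MetricSpace X]

theorem euclideanPlane_dist_sq (p q : EuclideanSpace ℝ (Fin 2)) :
    dist p q ^ 2 = (p 0 - q 0) ^ 2 + (p 1 - q 1) ^ 2 := by
  rw [EuclideanSpace.dist_eq, Real.sq_sqrt (by positivity)]
  simp [Fin.sum_univ_two, Real.dist_eq, sq_abs]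

/-- Half-flats in coordinates adapted to a parametrization of the boundary line. -/
theorem boundsHalfFlat_range_iff {c : ℝ → X} (hc : Isometry c) :
    BoundsHalfFlat (Set.range c) ↔ ∃ F : ℝ → ℝ → X, (∀ t, F t 0 = c t) ∧
      ∀ t t' v v', 0 ≤ v → 0 ≤ v' → dist (F t v) (F t' v') ^ 2 = (t - t') ^ 2 + (v - v') ^ 2 := by
  constructor
  · rintro ⟨f, hf, hfc⟩
    have : ∀ t, ∃ p : euclideanHalfPlane, (p : EuclideanSpace ℝ (Fin 2)) 1 = 0 ∧ f p = c t := by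
      intro t
      have : c t ∈ f '' {p | (p : EuclideanSpace ℝ (Fin 2)) 1 = 0} := hfc ▸ ⟨t, rfl⟩
      simpa using this
    choose P hP0 hP using this
    have hPd : ∀ t t', ((P t).1 0 - (P t').1 0) ^ 2 = (t - t') ^ 2 := by
      intro t t'
      have h1 := euclideanPlane_dist_sq (P t).1 (P t').1
      rw [hP0, hP0, ← Subtype.dist_eq, ← hf.dist_eq, hP, hP, hc.dist_eq, Real.dist_eq, sq_abs] at h1
      linarith
    refine ⟨fun t v => f ⟨!₂[(P t).1 0, max v 0], le_max_right v 0⟩, ?_, ?_⟩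
    · intro t
      rw [← hP t]
      refine congrArg f (Subtype.ext ?_)
      ext i
      fin_cases i <;> simp [hP0]
    · intro t t' v v' hv hv'
      rw [hf.dist_eq, Subtype.dist_eq, euclideanPlane_dist_sq]
      simp [hv, hv', hPd]
  · rintro ⟨F, hF0, hF⟩
    refine ⟨fun p => F (p.1 0) (p.1 1), Isometry.of_dist_eq fun p q => ?_, ?_⟩
    · have h := hF (p.1 0) (q.1 0) (p.1 1) (q.1 1) p.2 q.2
      rw [← euclideanPlane_dist_sq, ← Subtype.dist_eq] at h
      exact (sq_eq_sq₀ dist_nonneg dist_nonneg).1 h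
    · ext x
      constructor
      · rintro ⟨p, hp, rfl⟩
        refine ⟨p.1 0, ?_⟩
        have hp : p.1 1 = 0 := hp
        simp only [hp, hF0]
      · rintro ⟨t, rfl⟩
        refine ⟨⟨!₂[t, 0], le_refl (0 : ℝ)⟩, ?_, ?_⟩
        · simp
        · simp [hF0]

/-- A nonexpanding map of a half-plane that extends an isometric line and preserves, for each
point, the distance to one boundary point is isometric. -/
theorem isometric_halfPlane_of_nonexpanding (hX : IsCATZero X) {c : ℝ → X} (hc : Isometry c)
    {F : ℝ → ℝ → X} (hF0 : ∀ t, F t 0 = c t)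
    (hF : ∀ t t' v v', 0 ≤ v → 0 ≤ v' → dist (F t v) (F t' v') ^ 2 ≤ (t - t') ^ 2 + (v - v') ^ 2)
    (hd : ∀ u v, 0 ≤ v → ∃ t, dist (F u v) (c t) ^ 2 = (u - t) ^ 2 + v ^ 2)
    (t t' v v' : ℝ) (hv : 0 ≤ v) (hv' : 0 ≤ v') :
    dist (F t v) (F t' v') ^ 2 = (t - t') ^ 2 + (v - v') ^ 2 := by
  -- The foot `c s` is the midpoint of `c t` and its reflection. Equality at `s` leaves no slack in
  -- Stewart's inequality, so the upper bounds at both ends are attained.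
  have bd : ∀ u v t, 0 ≤ v → dist (F u v) (c t) ^ 2 = (u - t) ^ 2 + v ^ 2 := by
    intro u v t hv
    obtain ⟨s, hs⟩ := hd u v hv
    have hm : IsBetween (c (2 * s - t)) (c t) (1 / 2) (c s) := by
      simp only [IsBetween, hc.dist_eq, Real.dist_eq]
      rw [show 2 * s - t - s = s - t by ring, show 2 * s - t - t = 2 * (s - t) by ring, abs_mul]
      constructor <;> rw [abs_two] <;> ring
    have h := hX.stewart (by norm_num) (by norm_num) hm (F u v)
    have e1 := hF u (2 * s - t) v 0 hv le_rfl
    have e2 := hF u t v 0 hv le_rfl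
    rw [hF0] at e1 e2
    have e3 : dist (c (2 * s - t)) (c t) ^ 2 = (2 * (s - t)) ^ 2 := by
      rw [hc.dist_eq, Real.dist_eq, sq_abs]; ring
    rw [e3, hs] at h
    refine le_antisymm (by linarith) ?_
    nlinarith
  have strict : ∀ t t' v v', 0 ≤ v → v < v' →
      dist (F t v) (F t' v') ^ 2 = (t - t') ^ 2 + (v - v') ^ 2 := by
    intro t t' v v' hv hvv
    have hv'0 : 0 < v' := by linarith
    refine le_antisymm (hF _ _ _ _ hv hv'0.le) ?_
    set r := v / v' with hr
    have hrv : r * v' = v := by rw [hr]; field_simp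
    have hr0 : 0 ≤ r := by positivity
    have hr1 : r < 1 := by rw [hr, div_lt_one hv'0]; exact hvv
    have h1r : 0 < 1 - r := by linarith
    -- The Euclidean line from `(t', v')` through `(t, v)` meets the boundary at `o`. Distances to
    -- `c o` are exact, so the triangle inequality gives the lower bound.
    obtain ⟨o, ho⟩ : ∃ o, (1 - r) * o = t - r * t' :=
      ⟨(t - r * t') / (1 - r), by field_simp⟩
    have hQ := bd t' v' o hv'0.le
    have hP := bd t v o hv
    have et : t - o = r * (t' - o) := by linarith
    have ev : v = r * v' := hrv.symm
    have hPle : dist (F t v) (c o) = r * dist (F t' v') (c o) := by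
      rw [← sq_eq_sq₀ dist_nonneg (by positivity), mul_pow, hP, hQ, et, ev]; ring
    have tri := dist_triangle (F t' v') (F t v) (c o)
    have : (1 - r) * dist (F t' v') (c o) ≤ dist (F t v) (F t' v') := by
      rw [dist_comm (F t v)]; linarith
    have := pow_le_pow_left₀ (by positivity) this 2
    rw [mul_pow, hQ] at this
    have e : t - t' = -((1 - r) * (t' - o)) := by linarith
    have e' : v - v' = -((1 - r) * v') := by linarith
    rw [e, e']
    linarith
  rcases lt_trichotomy v v' with h | rfl | h
  · exact strict t t' v v' hv h
  · refine le_antisymm (hF _ _ _ _ hv hv) ?_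
    -- For equal heights the line is parallel to the boundary, so one point is raised by `ε`.
    have : |t - t'| ≤ dist (F t v) (F t' v) := by
      refine le_of_forall_pos_le_add fun ε hε => ?_
      have h1 := strict t' t v (v + ε) hv (by linarith)
      have h2 := hF t t (v + ε) v (by linarith) hv
      have h3 : dist (F t (v + ε)) (F t v) ≤ ε := by
        refine le_of_sq_le_sq ?_ hε.le
        linarith
      have h4 : |t - t'| ≤ dist (F t' v) (F t (v + ε)) := by
        refine le_of_sq_le_sq ?_ dist_nonneg
        rw [h1, sq_abs]
        nlinarith
      linarith [dist_triangle (F t' v) (F t v) (F t (v + ε)), dist_comm (F t' v) (F t v),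
        dist_comm (F t v) (F t (v + ε))]
    have := pow_le_pow_left₀ (abs_nonneg _) this 2
    rw [sq_abs] at this
    linarith
  · rw [dist_comm, strict t' t v' v hv' h]; ring

/-- If points `w i` go to infinity so that the Busemann function in the limit is affine along a
line with slope different from `1` and `-1`, then the line bounds a half-flat. -/
theorem boundsHalfFlat_of_tendsto [ProperSpace X] (hX : IsCATZero X) {c : ℝ → X} (hc : Isometry c)
    {ι : Type*} (U : Ultrafilter ι) (w : ι → X) {σ : ℝ} (hσ : |σ| < 1)
    (h0 : Tendsto (fun i => dist (w i) (c 0)) U atTop)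
    (hb : ∀ t, Tendsto (fun i => dist (w i) (c t) - dist (w i) (c 0)) U (𝓝 (σ * t))) :
    BoundsHalfFlat (Set.range c) := by
  have hA : ∀ t, Tendsto (fun i => dist (w i) (c t)) U atTop := by
    intro t
    refine tendsto_atTop_mono (fun i => ?_) (tendsto_atTop_add_const_right _ (-|t|) h0)
    have := dist_triangle (w i) (c t) (c 0)
    rw [hc.dist_eq t 0, Real.dist_eq, sub_zero] at this
    linarith
  have hdiff : ∀ t t', Tendsto (fun i => dist (w i) (c t) - dist (w i) (c t')) U
      (𝓝 (σ * (t - t'))) := by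
    intro t t'
    have := (hb t).sub (hb t')
    rw [← mul_sub] at this
    refine this.congr fun i => by ring
  -- `P i t s` is the point at distance `s` from `c t` on the way to `w i`. Outside the valid range
  -- it is arbitrary, but the range condition holds eventually.
  have : ∀ i t s, ∃ p, 0 ≤ s → s ≤ dist (w i) (c t) →
      IsBetween (w i) (c t) (1 - s / dist (w i) (c t)) p := by
    intro i t s
    by_cases h : 0 ≤ s ∧ s ≤ dist (w i) (c t)
    · obtain ⟨p, hp⟩ := hX.exists_isBetween (w i) (c t) (r := 1 - s / dist (w i) (c t))
        (by linarith [div_le_one_of_le₀ h.2 dist_nonneg])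
        (by linarith [div_nonneg h.1 (dist_nonneg (x := w i) (y := c t))])
      exact ⟨p, fun _ _ => hp⟩
    · exact ⟨w i, fun h1 h2 => absurd ⟨h1, h2⟩ h⟩
  choose P hP using this
  have hPs : ∀ t s, 0 ≤ s → ∀ᶠ i in (U : Filter ι), dist (P i t s) (c t) = s := by
    intro t s hs
    filter_upwards [(hA t).eventually_ge_atTop s, (hA t).eventually_gt_atTop 0] with i h1 h2
    rw [(hP i t s hs h1).2]
    field_simp
    ring
  have : ∀ t s, ∃ x, 0 ≤ s → Tendsto (fun i => P i t s) U (𝓝 x) := by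
    intro t s
    by_cases hs : 0 ≤ s
    · obtain ⟨x, -, hx⟩ := isCompact_iff_ultrafilter_le_nhds.1 (isCompact_closedBall (c t) s)
        (U.map fun i => P i t s) (by
          rw [le_principal_iff]
          exact (hPs t s hs).mono fun i hi => hi.le)
      exact ⟨x, fun _ => hx⟩
    · exact ⟨c 0, fun h => absurd h hs⟩
  choose H hH using this
  have hH1 : ∀ t s, 0 ≤ s → dist (H t s) (c t) = s := fun t s hs =>
    tendsto_nhds_unique ((hH t s hs).dist tendsto_const_nhds)
      (tendsto_const_nhds.congr' ((hPs t s hs).mono fun i hi => hi.symm))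
  -- Comparison in the triangles `w i`, `c t`, `c t'`, whose ratios tend to 1 as `w i` goes to
  -- infinity.
  have hH2 : ∀ t t' s s', 0 ≤ s → 0 ≤ s' → dist (H t s) (H t' s') ^ 2 ≤
      (σ * (t - t') - (s - s')) ^ 2 + ((t - t') ^ 2 - (σ * (t - t')) ^ 2) := by
    intro t t' s s' hs hs'
    have hr : ∀ t s, Tendsto (fun i => 1 - s / dist (w i) (c t)) U (𝓝 1) := by
      intro t s
      simpa using ((hA t).const_div_atTop s).const_sub 1
    have lim := (((hdiff t t').sub_const (s - s')).pow 2).add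
      (((hr t s).mul (hr t' s')).mul (((hdiff t t').pow 2).const_sub ((t - t') ^ 2)))
    rw [mul_one, one_mul] at lim
    refine le_of_tendsto_of_tendsto (((hH t s hs).dist (hH t' s' hs')).pow 2) lim ?_
    filter_upwards [(hA t).eventually_ge_atTop s, (hA t).eventually_gt_atTop 0,
      (hA t').eventually_ge_atTop s', (hA t').eventually_gt_atTop 0] with i h1 h2 h3 h4
    have key := hX.comparison_sq (by linarith [div_le_one_of_le₀ h1 dist_nonneg])
      (by linarith [div_nonneg hs h2.le]) (by linarith [div_le_one_of_le₀ h3 dist_nonneg])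
      (by linarith [div_nonneg hs' h4.le]) (hP i t s hs h1) (hP i t' s' hs' h3)
    rw [hc.dist_eq, Real.dist_eq, sq_abs] at key
    refine key.trans_eq ?_
    have e1 : (1 - s / dist (w i) (c t)) * dist (w i) (c t) = dist (w i) (c t) - s := by
      field_simp
    have e2 : (1 - s' / dist (w i) (c t')) * dist (w i) (c t') = dist (w i) (c t') - s' := by
      field_simp
    generalize dist (w i) (c t) = A at *
    generalize dist (w i) (c t') = A' at *
    generalize 1 - s / A = r at *
    generalize 1 - s' / A' = r' at *
    rw [show A - A' - (s - s') = r * A - r' * A' by rw [e1, e2]; ring]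
    ring
  have hσ2 : 0 < 1 - σ ^ 2 := by
    have := (sq_lt_one_iff_abs_lt_one σ).2 hσ
    linarith
  set κ := √(1 - σ ^ 2) with hκ
  have hκ0 : 0 < κ := Real.sqrt_pos.2 hσ2
  have hκ2 : κ ^ 2 = 1 - σ ^ 2 := Real.sq_sqrt hσ2.le
  rw [boundsHalfFlat_range_iff hc]
  have hz : ∀ t, H (t + σ * (0 / κ)) (0 / κ) = c t := by
    intro t
    have := hH1 t 0 le_rfl
    simpa using this
  -- In the half-plane the ray from `c t` has direction `(-σ, κ)`, so it passes through `(u, v)` at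
  -- time `v / κ` if `t = u + σ * (v / κ)`.
  refine ⟨fun u v => H (u + σ * (v / κ)) (v / κ), hz, ?_⟩
  refine isometric_halfPlane_of_nonexpanding hX hc hz ?_ ?_
  · intro t t' v v' hv hv'
    refine (hH2 _ _ _ _ (by positivity) (by positivity)).trans_eq ?_
    obtain ⟨y, rfl⟩ : ∃ y, v = κ * y := ⟨v / κ, by field_simp⟩
    obtain ⟨y', rfl⟩ : ∃ y, v' = κ * y := ⟨v' / κ, by field_simp⟩
    rw [mul_div_cancel_left₀ _ hκ0.ne', mul_div_cancel_left₀ _ hκ0.ne']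
    linear_combination (-(y - y') ^ 2) * hκ2
  · intro u v hv
    refine ⟨u + σ * (v / κ), ?_⟩
    rw [hH1 _ _ (by positivity)]
    obtain ⟨y, rfl⟩ : ∃ y, v = κ * y := ⟨v / κ, by field_simp⟩
    rw [mul_div_cancel_left₀ _ hκ0.ne']
    linear_combination (-y ^ 2) * hκ2

/-- A convex function on the line within bounded distance of a linear function is affine. -/
theorem eq_of_convexOn_of_bounded {b : ℝ → ℝ} (hb : ConvexOn ℝ Set.univ b) (h0 : b 0 = 0)
    {K : ℝ} (hK : ∀ t, |b t| ≤ K) (t : ℝ) : b t = 0 := by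
  have up : ∀ t, b t ≤ 0 := by
    intro t
    refine le_of_forall_pos_le_add fun ε hε => ?_
    obtain ⟨n, hn⟩ := exists_nat_gt (K / ε)
    have hK0 : 0 ≤ K := (abs_nonneg _).trans (hK 0)
    have hn0 : (0 : ℝ) < n := lt_of_le_of_lt (by positivity) hn
    -- `t` is the convex combination of 0 and `(n + 1) * t` with weight `1 / (n + 1)` on the far
    -- point, whence `b t ≤ K / (n + 1)`.
    have := hb.2 (Set.mem_univ 0) (Set.mem_univ (n * t + t))
      (show (0 : ℝ) ≤ n / (n + 1) by positivity) (show (0 : ℝ) ≤ 1 / (n + 1) by positivity)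
      (by field_simp)
    simp only [smul_eq_mul, mul_zero, zero_add, h0] at this
    rw [show 1 / ((n : ℝ) + 1) * (n * t + t) = t by field_simp] at this
    have h2 := (abs_le.1 (hK (n * t + t))).2
    have h3 : K / (n + 1) ≤ ε := by
      rw [div_lt_iff₀ hε] at hn
      rw [div_le_iff₀ (by positivity)]
      nlinarith
    have h4 : 1 / ((n : ℝ) + 1) * b (n * t + t) ≤ K / (n + 1) := by
      rw [one_div, div_eq_inv_mul]
      exact mul_le_mul_of_nonneg_left h2 (by positivity)
    linarith
  refine le_antisymm (up t) ?_
  have := hb.2 (Set.mem_univ t) (Set.mem_univ (-t)) (show (0 : ℝ) ≤ 1 / 2 by norm_num)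
    (show (0 : ℝ) ≤ 1 / 2 by norm_num) (by norm_num)
  simp only [smul_eq_mul] at this
  rw [show 1 / 2 * t + 1 / 2 * -t = 0 by ring, h0] at this
  linarith [up (-t)]

/-- Coarse version of `boundsHalfFlat_of_tendsto`. -/
theorem boundsHalfFlat_of_eventually_le [ProperSpace X] (hX : IsCATZero X) {c : ℝ → X}
    (hc : Isometry c) {ι : Type*} (U : Ultrafilter ι) (w : ι → X) {σ K : ℝ} (hσ : |σ| < 1)
    (h0 : Tendsto (fun i => dist (w i) (c 0)) U atTop)
    (hb : ∀ t, ∀ᶠ i in (U : Filter ι), |dist (w i) (c t) - dist (w i) (c 0) - σ * t| ≤ K) :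
    BoundsHalfFlat (Set.range c) := by
  -- The limits `β t` exist by compactness, since the differences are bounded by `|t|`; `β` is the
  -- limiting Busemann function.
  have : ∀ t, ∃ y ∈ Set.Icc (-|t|) |t|,
      Tendsto (fun i => dist (w i) (c t) - dist (w i) (c 0)) U (𝓝 y) := by
    intro t
    refine isCompact_iff_ultrafilter_le_nhds.1 isCompact_Icc
      (U.map fun i => dist (w i) (c t) - dist (w i) (c 0)) ?_
    rw [le_principal_iff]
    refine (Eventually.of_forall fun i => ?_ : ∀ᶠ i in (U : Filter ι), _ ∈ Set.Icc (-|t|) |t|)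
    have h1 := dist_triangle (w i) (c t) (c 0)
    have h2 := dist_triangle (w i) (c 0) (c t)
    rw [hc.dist_eq, Real.dist_eq, sub_zero] at h1
    rw [hc.dist_eq, Real.dist_eq, zero_sub, abs_neg] at h2
    exact ⟨by linarith, by linarith⟩
  choose β _ hβ using this
  have hβ0 : β 0 = 0 := tendsto_nhds_unique (hβ 0) (by simp)
  have hconv : ConvexOn ℝ Set.univ fun t => β t - σ * t := by
    refine ⟨convex_univ, fun x _ y _ a b ha hb' hab => ?_⟩
    have : β (a • x + b • y) ≤ a • β x + b • β y := by
      refine le_of_tendsto_of_tendsto (hβ (a • x + b • y))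
        (((hβ x).const_smul a).add ((hβ y).const_smul b)) (Eventually.of_forall fun i => ?_)
      have := (hX.convexOn_dist convex_univ (fun s _ t _ => hc.dist_eq s t) (w i)).2
        (Set.mem_univ x) (Set.mem_univ y) ha hb' hab
      simp only [smul_eq_mul] at this ⊢
      have e : a * dist (w i) (c 0) + b * dist (w i) (c 0) = dist (w i) (c 0) := by
        rw [← add_mul, hab, one_mul]
      linarith
    simp only [smul_eq_mul] at this ⊢
    linarith
  have hbound : ∀ t, |β t - σ * t| ≤ K := fun t =>
    le_of_tendsto ((hβ t).sub_const (σ * t)).abs (hb t)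
  refine boundsHalfFlat_of_tendsto hX hc U w hσ h0 fun t => ?_
  have := eq_of_convexOn_of_bounded hconv (by simp [hβ0]) hbound t
  rw [show σ * t = β t by linarith]
  exact hβ t

end HalfFlat

/-! ### No half-flat implies uniform contraction -/

section Contracting

theorem ConvexOn.secant_le_secant {φ : ℝ → ℝ} {I : Set ℝ} (hφ : ConvexOn ℝ I φ) {x y z w : ℝ}
    (hx : x ∈ I) (hy : y ∈ I) (hz : z ∈ I) (hw : w ∈ I) (hxy : x < y) (hzw : z < w)
    (hxz : x ≤ z) (hyw : y ≤ w) : (φ y - φ x) / (y - x) ≤ (φ w - φ z) / (w - z) := by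
  have h1 := hφ.secant_mono hx hy hw hxy.ne' (hxy.trans_le hyw).ne' hyw
  have h2 := hφ.secant_mono hw hx hz (hxy.trans_le hyw).ne hzw.ne hxz
  have e1 : (φ x - φ w) / (x - w) = (φ w - φ x) / (w - x) := by
    rw [← neg_sub w x, ← neg_sub (φ w), neg_div_neg_eq]
  have e2 : (φ z - φ w) / (z - w) = (φ w - φ z) / (w - z) := by
    rw [← neg_sub w z, ← neg_sub (φ w), neg_div_neg_eq]
  rw [e1, e2] at h2
  exact h1.trans h2

theorem exists_small_increment {u : ℕ → ℝ} {m : ℕ} (hm : 0 < m) (h0 : 0 ≤ u 0) (h1 : u m ≤ 1) :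
    ∃ i < m, u (i + 1) - u i ≤ 1 / m := by
  by_contra! h
  have h2 : ∑ i ∈ Finset.range m, (1 / m : ℝ) < ∑ i ∈ Finset.range m, (u (i + 1) - u i) :=
    Finset.sum_lt_sum_of_nonempty ⟨0, by simpa using hm⟩ fun i hi => h i (by simpa using hi)
  rw [Finset.sum_range_sub, Finset.sum_const, Finset.card_range, nsmul_eq_mul] at h2
  have : (m : ℝ) * (1 / m) = 1 := by field_simp
  linarith

/-- A convex function with slopes in `[0, 1]` has a nearly linear long stretch. -/
theorem ConvexOn.exists_nearly_linear {φ : ℝ → ℝ} {I : Set ℝ} (hφ : ConvexOn ℝ I φ) {M : ℕ}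
    (hM : 0 < M) {θ : ℝ} (hθ : θ ≤ 1) (hI : Set.Icc 0 (2 * (M : ℝ) ^ 2 + 1) ⊆ I)
    (h0 : ∀ t ∈ Set.Icc 0 (2 * (M : ℝ) ^ 2 + 1), φ 0 ≤ φ t)
    (h1 : φ (2 * (M : ℝ) ^ 2 + 1) - φ (2 * (M : ℝ) ^ 2) ≤ θ) :
    ∃ a σ : ℝ, (M : ℝ) ≤ a ∧ a + M ≤ 2 * (M : ℝ) ^ 2 + 1 ∧ 0 ≤ σ ∧ σ ≤ θ ∧
      ∀ t : ℝ, |t| ≤ M → |φ (a + t) - φ a - σ * t| ≤ |t| / M := by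
  have hM1 : (1 : ℝ) ≤ M := by exact_mod_cast hM
  -- `u i` is a unit secant slope sampled at spacing `2 * M`. The samples rise by at most 1 in `M`
  -- steps, so one step rises by at most `1 / M`.
  set u : ℕ → ℝ := fun i => φ (2 * M * i + 1) - φ (2 * M * i) with hu
  have hmem : ∀ x : ℝ, 0 ≤ x → x ≤ 2 * (M : ℝ) ^ 2 + 1 → x ∈ I := fun x hx hx' => hI ⟨hx, hx'⟩
  have sec : ∀ x y z w : ℝ, 0 ≤ x → w ≤ 2 * (M : ℝ) ^ 2 + 1 → x < y → z < w → x ≤ z → y ≤ w →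
      (φ y - φ x) / (y - x) ≤ (φ w - φ z) / (w - z) := fun x y z w hx hw hxy hzw hxz hyw =>
    hφ.secant_le_secant (hmem x hx (by linarith)) (hmem y (by linarith) (by linarith))
      (hmem z (by linarith) (by linarith)) (hmem w (by linarith) hw) hxy hzw hxz hyw
  have hu0 : 0 ≤ u 0 := by
    have := h0 1 ⟨by norm_num, by nlinarith⟩
    simp only [hu, Nat.cast_zero, mul_zero, zero_add]
    linarith
  have huM : u M ≤ θ := by
    simp only [hu]
    rw [show 2 * (M : ℝ) * M = 2 * (M : ℝ) ^ 2 by ring]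
    exact h1
  obtain ⟨i, hiM, hi⟩ := exists_small_increment hM hu0 (huM.trans hθ)
  have hiM' : (i : ℝ) + 1 ≤ M := by exact_mod_cast hiM
  have hi0 : (0 : ℝ) ≤ i := by positivity
  have hb0 : 0 ≤ 2 * (M : ℝ) * i := by positivity
  have hb1 : 2 * (M : ℝ) * i + 2 * M ≤ 2 * (M : ℝ) ^ 2 := by nlinarith
  have hui : ∀ j : ℕ, u j = (φ (2 * M * j + 1) - φ (2 * M * j)) / (2 * M * j + 1 - 2 * M * j) := by
    intro j; simp [hu]
  have hi' : u (i + 1) =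
      (φ (2 * M * i + 2 * M + 1) - φ (2 * M * i + 2 * M)) /
        (2 * M * i + 2 * M + 1 - (2 * M * i + 2 * M)) := by
    rw [hui]; push_cast; ring_nf
  -- `a` is the midpoint of the chosen gap. Secants between `a` and `a + t` have slopes between `u
  -- i` and `u (i + 1)`.
  refine ⟨2 * M * i + M, u i, by linarith, by linarith, ?_, ?_, ?_⟩
  · refine hu0.trans ?_
    rw [hui 0, hui i]
    simp only [Nat.cast_zero, mul_zero]
    exact sec _ _ _ _ le_rfl (by linarith) (by linarith) (by linarith) hb0 (by linarith)
  · refine le_trans ?_ huM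
    rw [hui i, hui M]
    have : 2 * (M : ℝ) * M = 2 * (M : ℝ) ^ 2 := by ring
    rw [this]
    exact sec _ _ _ _ hb0 le_rfl (by linarith) (by linarith) (by linarith) (by linarith)
  · intro t ht
    rcases lt_trichotomy t 0 with h | rfl | h
    · rw [abs_of_neg h] at ht ⊢
      have s1 := sec (2 * M * i) (2 * M * i + 1) (2 * M * i + M + t) (2 * M * i + M) hb0
        (by linarith) (by linarith) (by linarith) (by linarith) (by linarith)
      have s2 := sec (2 * M * i + M + t) (2 * M * i + M) (2 * M * i + 2 * M)
        (2 * M * i + 2 * M + 1) (by linarith) (by linarith) (by linarith) (by linarith)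
        (by linarith) (by linarith)
      rw [← hui i] at s1
      rw [← hi'] at s2
      have e : (2 * (M : ℝ) * i + M - (2 * M * i + M + t)) = -t := by ring
      rw [e] at s1 s2
      have ht' : 0 < -t := by linarith
      rw [le_div_iff₀ ht'] at s1
      rw [div_le_iff₀ ht'] at s2
      have s3 : (u (i + 1) - u i) * -t ≤ -t / M := by
        rw [div_eq_inv_mul, ← one_div]; exact mul_le_mul_of_nonneg_right hi ht'.le
      rw [abs_le]
      constructor <;> nlinarith
    · simp
    · rw [abs_of_pos h] at ht ⊢
      have s1 := sec (2 * M * i) (2 * M * i + 1) (2 * M * i + M) (2 * M * i + M + t) hb0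
        (by linarith) (by linarith) (by linarith) (by linarith) (by linarith)
      have s2 := sec (2 * M * i + M) (2 * M * i + M + t) (2 * M * i + 2 * M)
        (2 * M * i + 2 * M + 1) (by linarith) (by linarith) (by linarith) (by linarith)
        (by linarith) (by linarith)
      rw [← hui i] at s1
      rw [← hi'] at s2
      have e : (2 * (M : ℝ) * i + M + t - (2 * M * i + M)) = t := by ring
      rw [e] at s1 s2
      rw [le_div_iff₀ h] at s1
      rw [div_le_iff₀ h] at s2
      have s3 : (u (i + 1) - u i) * t ≤ t / M := by
        rw [div_eq_inv_mul, ← one_div]; exact mul_le_mul_of_nonneg_right hi h.le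
      rw [abs_le]
      constructor <;> nlinarith

variable {X : Type*} [MetricSpace X]

theorem IsometryEquiv.zpow_translation {g : X ≃ᵢ X} {ℓ : ℝ → X} {τ : ℝ}
    (hg : ∀ t, g (ℓ t) = ℓ (t + τ)) (k : ℤ) (t : ℝ) : (g ^ k) (ℓ t) = ℓ (t + k * τ) := by
  induction k using Int.induction_on generalizing t with
  | zero => simp
  | succ n ih =>
    rw [zpow_add_one, IsometryEquiv.mul_apply, hg, ih]
    push_cast; ring_nf
  | pred n ih =>
    have h : (g⁻¹ : X ≃ᵢ X) (ℓ t) = ℓ (t - τ) := by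
      apply g.injective
      rw [hg, ← IsometryEquiv.mul_apply, mul_inv_cancel]
      simp
    rw [zpow_sub_one, IsometryEquiv.mul_apply, h, ih]
    push_cast; ring_nf

theorem IsometryEquiv.dist_zpow_neg (g : X ≃ᵢ X) (k : ℤ) (x y : X) :
    dist ((g ^ (-k)) x) y = dist x ((g ^ k) y) := by
  rw [← (g ^ k).dist_eq, ← IsometryEquiv.mul_apply, ← zpow_add]
  simp

/-- Far along a geodesic that fellow-travels an axis without half-flats, the distance to a point
projecting to the initial point grows with slope almost one. -/
theorem exists_slope_bound [ProperSpace X] (hX : IsCATZero X) {g : X ≃ᵢ X} {ℓ : ℝ → X}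
    (hℓ : Isometry ℓ) {τ : ℝ} (hτ : 0 < τ) (hg : ∀ t, g (ℓ t) = ℓ (t + τ))
    (hflat : ¬ BoundsHalfFlat (Set.range ℓ)) (R : ℝ) :
    ∃ N : ℝ, 1 ≤ N ∧ ∀ (T s₀ : ℝ) (c : ℝ → X) (z : X),
      (∀ s ∈ Set.Icc 0 T, ∀ t ∈ Set.Icc 0 T, dist (c s) (c t) = |s - t|) →
      (∀ t ∈ Set.Icc 0 T, dist (c t) (ℓ (t + s₀)) ≤ R) →
      (∀ t ∈ Set.Icc 0 T, dist z (c 0) ≤ dist z (c t)) →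
      ∀ v v', N ≤ v → v ≤ v' → v' ≤ T → 31 / 32 * (v' - v) ≤ dist z (c v') - dist z (c v) := by
  by_contra! hcon
  have stretch : ∀ m : ℕ, ∃ (w : X) (σ : ℝ), σ ∈ Set.Icc (0 : ℝ) (31 / 32) ∧
      (m : ℝ) / 2 - (R + τ) ≤ dist w (ℓ 0) ∧
      ∀ t : ℝ, |t| ≤ m → |dist w (ℓ t) - dist w (ℓ 0) - σ * t| ≤ 2 * (R + τ) + 1 := by
    intro m
    set M : ℕ := m + 1 with hM
    have hmM : (m : ℝ) ≤ M := by simp [hM]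
    have hM0 : 0 < M := Nat.succ_pos m
    have hM0' : (0 : ℝ) < M := by exact_mod_cast hM0
    obtain ⟨T, s₀, c, z, hc, hR, hz, v, v', hv, hvv, hv', hlt⟩ :=
      hcon (2 * (M : ℝ) ^ 2 + 1) (by nlinarith)
    have hconv := hX.convexOn_dist (convex_Icc 0 T) hc z
    have hvv : v < v' := by
      rcases hvv.lt_or_eq with h | rfl
      · exact h
      · simp at hlt
    have hsub : Set.Icc 0 (2 * (M : ℝ) ^ 2 + 1) ⊆ Set.Icc 0 T :=
      Set.Icc_subset_Icc_right (by linarith)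
    obtain ⟨a, σ, ha, haM, hσ0, hσ1, hσ⟩ := hconv.exists_nearly_linear hM0 (θ := 31 / 32)
      (by norm_num) hsub (fun t ht => hz t (hsub ht)) (by
        -- Convexity carries the small slope on the later interval `[v, v']` back to this unit
        -- interval.
        have := hconv.secant_le_secant (x := 2 * (M : ℝ) ^ 2) (y := 2 * (M : ℝ) ^ 2 + 1)
          (z := v) (w := v') (hsub ⟨by positivity, by linarith⟩) (hsub ⟨by positivity, le_rfl⟩)
          ⟨by nlinarith, by linarith⟩ ⟨by nlinarith, hv'⟩ (by linarith) hvv (by linarith)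
          (by linarith)
        rw [add_sub_cancel_left, div_one] at this
        refine this.trans ?_
        rw [div_le_iff₀ (by linarith)]
        exact hlt.le)
    -- `g ^ (-k)` moves the centre of the stretch to within `R + τ` of `ℓ 0`.
    set k := ⌊(s₀ + a) / τ⌋ with hk
    have hk1 : (k : ℝ) * τ ≤ s₀ + a := by
      rw [← le_div_iff₀ hτ]; exact Int.floor_le _
    have hk2 : s₀ + a < (k + 1) * τ := by
      rw [← div_lt_iff₀ hτ]; exact Int.lt_floor_add_one _
    have near : ∀ t : ℝ, |t| ≤ M → |dist ((g ^ (-k)) z) (ℓ t) - dist z (c (a + t))| ≤ R + τ := by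
      intro t ht
      rw [abs_le] at ht
      rw [g.dist_zpow_neg, IsometryEquiv.zpow_translation hg]
      have h1 := hR (a + t) (hsub ⟨by linarith, by linarith⟩)
      have h2 : dist (ℓ (a + t + s₀)) (ℓ (t + k * τ)) ≤ τ := by
        rw [hℓ.dist_eq, Real.dist_eq, abs_le]
        constructor <;> linarith
      have h3 := dist_triangle z (c (a + t)) (ℓ (t + k * τ))
      have h4 := dist_triangle_right z (c (a + t)) (ℓ (t + k * τ))
      have h5 := dist_triangle (c (a + t)) (ℓ (a + t + s₀)) (ℓ (t + k * τ))
      rw [abs_le]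
      constructor <;> linarith
    have n0 := near 0 (by simp)
    rw [add_zero] at n0
    refine ⟨(g ^ (-k)) z, σ, ⟨hσ0, hσ1⟩, ?_, ?_⟩
    · have ha' : a ∈ Set.Icc 0 T := hsub ⟨by linarith, by linarith⟩
      have h0' : (0 : ℝ) ∈ Set.Icc 0 T := ⟨le_rfl, by linarith [ha'.1, ha'.2]⟩
      -- As `c 0` is nearest to `z`, `a = dist (c a) (c 0) ≤ 2 * dist z (c a)`; hence the points `w`
      -- go to infinity.
      have h1 := hz a ha'
      have h2 := dist_triangle (c a) z (c 0)
      rw [hc a ha' 0 h0', sub_zero, abs_of_nonneg ha'.1, dist_comm _ z] at h2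
      have := (abs_le.1 n0).1
      linarith
    · intro t ht
      have h1 := hσ t (ht.trans hmM)
      have h2 : |t| / M ≤ 1 := by
        rw [div_le_one hM0']; exact ht.trans hmM
      have h3 := near t (ht.trans hmM)
      rw [abs_le] at h1 h3 n0 ⊢
      constructor <;> linarith
  choose w σ hσ hw0 hw using stretch
  obtain ⟨s, hs, hσs⟩ := isCompact_iff_ultrafilter_le_nhds.1
    (isCompact_Icc (a := (0 : ℝ)) (b := 31 / 32)) ((hyperfilter ℕ).map σ) (by
      rw [le_principal_iff]
      exact (Eventually.of_forall hσ : ∀ᶠ i in (hyperfilter ℕ : Filter ℕ), _ ∈ _))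
  have hσs : Tendsto σ (hyperfilter ℕ) (𝓝 s) := hσs
  have hat : (hyperfilter ℕ : Filter ℕ) ≤ atTop := Nat.hyperfilter_le_atTop
  refine hflat (boundsHalfFlat_of_eventually_le hX hℓ (hyperfilter ℕ) w (σ := s)
    (K := 2 * (R + τ) + 2) (by rw [abs_lt]; constructor <;> linarith [hs.1, hs.2]) ?_ ?_)
  · refine tendsto_atTop_mono hw0 (tendsto_atTop_add_const_right _ _ ?_)
    exact (tendsto_natCast_atTop_atTop.atTop_div_const two_pos).mono_left hat
  · intro t
    have h1 : Tendsto (fun i => |(σ i - s) * t|) (hyperfilter ℕ) (𝓝 0) := by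
      simpa using ((hσs.sub_const s).mul_const t).abs
    filter_upwards [hat (tendsto_natCast_atTop_atTop.eventually_ge_atTop |t|),
      h1.eventually_le_const zero_lt_one] with i hi hi'
    have := hw i t hi
    rw [abs_le] at this hi' ⊢
    constructor <;> linarith

/-- A comparison criterion for a triangle to be obtuse at `p`: the sides leave `p` almost in the
opposite directions `y` and `y'`. -/
theorem IsCATZero.dist_sq_add_dist_sq_le (hX : IsCATZero X) {p x z y y' : X} (hy : dist p y = 1)
    (hy' : dist p y' = 1) (hyy : dist y y' = 2) (hx1 : 1 ≤ dist x p) (hz1 : 1 ≤ dist z p)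
    (hx : dist x y + 31 / 32 ≤ dist x p) (hz : dist z y' + 31 / 32 ≤ dist z p) :
    dist x p ^ 2 + dist z p ^ 2 ≤ dist x z ^ 2 := by
  have side : ∀ x y : X, dist p y = 1 → 1 ≤ dist x p → dist x y + 31 / 32 ≤ dist x p →
      ∃ q, IsBetween p x (1 / dist x p) q ∧ dist q y ≤ 1 / 4 := by
    intro x y hy hx1 hx
    have hr0 : 0 ≤ 1 / dist x p := by positivity
    have hr1 : 1 / dist x p ≤ 1 := by rw [div_le_one (by linarith)]; exact hx1
    obtain ⟨q, hq⟩ := hX.exists_isBetween p x hr0 hr1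
    refine ⟨q, hq, ?_⟩
    have h := hX.stewart hr0 hr1 hq y
    rw [dist_comm y p, hy, dist_comm y x, dist_comm p x, dist_comm y q] at h
    have e : 1 / dist x p * dist x p = 1 := by field_simp
    have h2 : dist x y ^ 2 ≤ (dist x p - 31 / 32) ^ 2 :=
      pow_le_pow_left₀ dist_nonneg (by linarith) 2
    have h3 := mul_le_mul_of_nonneg_left h2 hr0
    generalize 1 / dist x p = r at *
    generalize dist x p = A at *
    have h4 : r * (A - 31 / 32) ^ 2 = A - 31 / 16 + (31 / 32) ^ 2 * r := by
      linear_combination (A - 31 / 16) * e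
    have h5 : r * (1 - r) * A ^ 2 = A - 1 := by
      linear_combination (A - r * A - 1) * e
    -- Stewart's bound becomes 1/16 minus a nonnegative multiple of `r`, and 1/16 is `2 * (1 -
    -- 31/32)`.
    refine le_of_sq_le_sq ?_ (by norm_num)
    nlinarith
  obtain ⟨q, hq, hqy⟩ := side x y hy hx1 hx
  obtain ⟨q', hq', hqy'⟩ := side z y' hy' hz1 hz
  have hr0 : 0 < 1 / dist x p := by positivity
  have hr1 : 1 / dist x p ≤ 1 := by rw [div_le_one (by linarith)]; exact hx1
  have hs0 : 0 < 1 / dist z p := by positivity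
  have hs1 : 1 / dist z p ≤ 1 := by rw [div_le_one (by linarith)]; exact hz1
  have h := hX.comparison_sq hr0.le hr1 hs0.le hs1 hq hq'
  have e1 : 1 / dist x p * dist x p = 1 := by field_simp
  have e2 : 1 / dist z p * dist z p = 1 := by field_simp
  -- An angle with unit sides is obtuse once the opposite side squared exceeds 2; here it is at
  -- least 9/4.
  have tri : 3 / 2 ≤ dist q q' := by
    linarith [dist_triangle y q y', dist_triangle q q' y', dist_comm y q]
  rw [dist_comm p x, dist_comm p z, ← mul_pow, ← mul_pow, e1, e2] at h
  by_contra! hlt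
  have : 0 < 1 / dist x p * (1 / dist z p) * (dist x p ^ 2 + dist z p ^ 2 - dist x z ^ 2) :=
    mul_pos (mul_pos hr0 hs0) (by linarith)
  nlinarith

/-- Geodesics fellow-travelling an axis that bounds no half-flat are uniformly contracting. -/
theorem exists_uniform_contracting [ProperSpace X] (hX : IsCATZero X) {g : X ≃ᵢ X} {ℓ : ℝ → X}
    (hℓ : Isometry ℓ) {τ : ℝ} (hτ : 0 < τ) (hg : ∀ t, g (ℓ t) = ℓ (t + τ))
    (hflat : ¬ BoundsHalfFlat (Set.range ℓ)) (R : ℝ) :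
    ∃ B : ℝ, 0 < B ∧ ∀ (c : ℝ → X) (I : Set ℝ), Convex ℝ I → IsClosed (c '' I) →
      (∀ s ∈ I, ∀ t ∈ I, dist (c s) (c t) = |s - t|) → (∀ t ∈ I, dist (c t) (ℓ t) ≤ R) →
      IsContracting B (c '' I) := by
  obtain ⟨N₁, hN₁1, hN₁⟩ := exists_slope_bound hX hℓ hτ hg hflat R
  have hrange : Set.range (fun t => ℓ (-t)) = Set.range ℓ := by
    ext x
    constructor
    · rintro ⟨t, rfl⟩; exact ⟨-t, rfl⟩
    · rintro ⟨t, rfl⟩; exact ⟨-t, by simp⟩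
  -- The same bound for the reversed axis, translated by the inverse of `g`, controls the geodesic
  -- from its other end.
  obtain ⟨N₂, hN₂1, hN₂⟩ := exists_slope_bound hX (g := g.symm) (ℓ := fun t => ℓ (-t))
    (hℓ.comp (IsometryEquiv.neg ℝ).isometry) hτ
    (by
      intro t
      rw [IsometryEquiv.symm_apply_eq, hg]
      congr 1; ring) (by rwa [hrange]) R
  set N := max N₁ N₂ with hN
  have hNN₁ : N₁ ≤ N := le_max_left _ _
  have hNN₂ : N₂ ≤ N := le_max_right _ _
  -- Every projection lies within `2 * N + 2` of the foot of the centre; the final 1 makes the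
  -- inequality strict.
  refine ⟨2 * (2 * N + 2) + 1, by linarith, ?_⟩
  intro c I hI hcl hc hR
  have sep : ∀ a ∈ I, ∀ b ∈ I, 2 * N + 2 < b - a → ∀ z x : X,
      (∀ t ∈ I, dist z (c a) ≤ dist z (c t)) → (∀ t ∈ I, dist x (c b) ≤ dist x (c t)) →
      dist z (c a) < dist z x ∧ dist x (c b) < dist z x := by
    intro a ha b hb hab z x hz hx
    have hsub : Set.Icc a b ⊆ I := hI.ordConnected.out ha hb
    -- At the midpoint both `m - 1` and `m + 1` are at least `N` away from their respective ends, so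
    -- both slope bounds apply.
    obtain ⟨m, hm⟩ : ∃ m, m = (a + b) / 2 := ⟨_, rfl⟩
    have hmI : m ∈ I := hsub ⟨by linarith, by linarith⟩
    have hm1 : m + 1 ∈ I := hsub ⟨by linarith, by linarith⟩
    have hm2 : m - 1 ∈ I := hsub ⟨by linarith, by linarith⟩
    have f := hN₁ (b - a) a (fun t => c (a + t)) z
      (fun s hs t ht => by
        rw [hc _ (hsub ⟨by linarith [hs.1], by linarith [hs.2]⟩) _
          (hsub ⟨by linarith [ht.1], by linarith [ht.2]⟩)]
        congr 1; ring)
      (fun t ht => by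
        rw [add_comm t a]; exact hR _ (hsub ⟨by linarith [ht.1], by linarith [ht.2]⟩))
      (fun t ht => by
        simpa using hz _ (hsub ⟨by linarith [ht.1], by linarith [ht.2]⟩))
      (m - 1 - a) (m - a) (by linarith) (by linarith) (by linarith)
    have f' := hN₂ (b - a) (-b) (fun t => c (b - t)) x
      (fun s hs t ht => by
        rw [hc _ (hsub ⟨by linarith [hs.2], by linarith [hs.1]⟩) _
          (hsub ⟨by linarith [ht.2], by linarith [ht.1]⟩), abs_sub_comm]
        congr 1; ring)
      (fun t ht => by
        rw [show -(t + -b) = b - t by ring]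
        exact hR _ (hsub ⟨by linarith [ht.2], by linarith [ht.1]⟩))
      (fun t ht => by
        simpa using hx _ (hsub ⟨by linarith [ht.2], by linarith [ht.1]⟩))
      (b - (m + 1)) (b - m) (by linarith) (by linarith) (by linarith)
    simp only [add_sub_cancel, sub_sub_cancel] at f f'
    have z1 := hz m hmI
    have x1 := hx m hmI
    have z2 := dist_triangle (c m) z (c a)
    have x2 := dist_triangle (c b) x (c m)
    rw [hc _ hmI _ ha, abs_of_nonneg (by linarith), dist_comm _ z] at z2
    rw [hc _ hb _ hmI, abs_of_nonneg (by linarith), dist_comm _ x] at x2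
    have z3 := hz _ hm2
    have x3 := hx _ hm1
    have obt := hX.dist_sq_add_dist_sq_le (p := c m) (x := x) (z := z) (y := c (m + 1))
      (y' := c (m - 1)) (by rw [hc _ hmI _ hm1]; norm_num) (by rw [hc _ hmI _ hm2]; norm_num)
      (by rw [hc _ hm1 _ hm2, show m + 1 - (m - 1) = 2 by ring]; norm_num)
      (by linarith) (by linarith) (by linarith) (by linarith)
    rw [dist_comm x z] at obt
    constructor
    · refine lt_of_lt_of_le (b := dist z (c m)) (by linarith) ?_
      refine le_of_sq_le_sq ?_ dist_nonneg
      nlinarith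
    · refine lt_of_lt_of_le (b := dist x (c m)) (by linarith) ?_
      refine le_of_sq_le_sq ?_ dist_nonneg
      nlinarith
  intro K hK hdisj
  -- This property of the centre treats open and closed balls alike, with no reference to the
  -- radius.
  obtain ⟨z, hzK⟩ : ∃ z, ∀ x ∈ K, ∀ y ∉ K, dist z x ≤ dist z y := by
    obtain ⟨z, r, rfl | rfl⟩ := hK
    · refine ⟨z, fun x hx y hy => ?_⟩
      rw [Metric.mem_ball'] at hx hy
      linarith
    · refine ⟨z, fun x hx y hy => ?_⟩
      rw [Metric.mem_closedBall'] at hx hy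
      linarith
  have hle : Metric.ediam (⋃ x ∈ K, nearestPoints (c '' I) x) ≤
      ENNReal.ofReal (2 * (2 * N + 2)) := by
    rcases Set.eq_empty_or_nonempty (c '' I) with he | hne
    · simp [nearestPoints, he]
    obtain ⟨_, ⟨a, ha, rfl⟩, hamin⟩ := hcl.exists_infDist_eq_dist hne z
    have hza : ∀ t ∈ I, dist z (c a) ≤ dist z (c t) := fun t ht => by
      rw [← hamin]; exact Metric.infDist_le_dist_of_mem ⟨t, ht, rfl⟩
    have near : ∀ y ∈ ⋃ x ∈ K, nearestPoints (c '' I) x, dist y (c a) ≤ 2 * N + 2 := by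
      intro y hy
      simp only [Set.mem_iUnion] at hy
      obtain ⟨x, hxK, ⟨b, hb, rfl⟩, hxb⟩ := hy
      have hxb : ∀ t ∈ I, dist x (c b) ≤ dist x (c t) := fun t ht => hxb _ ⟨t, ht, rfl⟩
      have hzx := hzK x hxK (c a) (fun h => Set.disjoint_left.1 hdisj h ⟨a, ha, rfl⟩)
      rw [hc b hb a ha]
      by_contra! hlt
      rcases lt_abs.1 hlt with h | h
      · exact absurd (sep a ha b hb h z x hza hxb).1 (not_lt.2 hzx)
      · have := (sep b hb a ha (by linarith) x z hxb hza).2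
        rw [dist_comm x z] at this
        linarith
    refine Metric.ediam_le fun y hy y' hy' => ?_
    rw [edist_dist]
    refine ENNReal.ofReal_le_ofReal ?_
    linarith [dist_triangle_right y y' (c a), near y hy, near y' hy']
  refine hle.trans_lt ((ENNReal.ofReal_lt_ofReal_iff (by linarith)).2 (by linarith))

end Contracting

/-! ### Axes, displacement and half-flats -/

section Axes

variable {X : Type*} [MetricSpace X]

theorem IsometryEquiv.pow_apply_eq_iterate (g : X ≃ᵢ X) (n : ℕ) (x : X) :
    (g ^ n) x = g^[n] x := by
  induction n generalizing x with
  | zero => rfl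
  | succ n ih => rw [pow_succ, IsometryEquiv.mul_apply, ih, Function.iterate_succ_apply]

theorem IsometryEquiv.dist_pow_le (g : X ≃ᵢ X) (n : ℕ) (x : X) :
    dist x ((g ^ n) x) ≤ n * dist x (g x) := by
  induction n with
  | zero => simp
  | succ n ih =>
    have := dist_triangle x ((g ^ n) x) ((g ^ (n + 1)) x)
    rw [pow_succ, IsometryEquiv.mul_apply, (g ^ n).dist_eq] at this
    rw [pow_succ, IsometryEquiv.mul_apply]
    push_cast
    linarith

/-- An isometry whose displacement attains a positive minimum on an invariant set closed under
midpoints has an axis. -/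
theorem IsCATZero.exists_isAxis (hX : IsCATZero X) {g : X ≃ᵢ X} {C : Set X}
    (hgC : ∀ y ∈ C, g y ∈ C) (hmid : ∀ a ∈ C, ∀ b ∈ C, ∀ m, IsBetween a b (1 / 2) m → m ∈ C)
    {x : X} (hx : x ∈ C) (hpos : 0 < dist x (g x))
    (hmin : ∀ y ∈ C, dist x (g x) ≤ dist y (g y)) : ∃ l, IsAxis g l := by
  obtain ⟨τ, hτ⟩ : ∃ τ, τ = dist x (g x) := ⟨_, rfl⟩
  rw [← hτ] at hpos hmin
  have hpowC : ∀ (n : ℕ), ∀ y ∈ C, (g ^ n) y ∈ C := by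
    intro n
    induction n with
    | zero => exact fun y hy => hy
    | succ n ih =>
      intro y hy
      rw [pow_succ, IsometryEquiv.mul_apply]
      exact ih _ (hgC y hy)
  -- The midpoint `m` of `y` and `g ^ 2 ^ k` applied to `y` is moved by that power at most half as
  -- far as its square moves `y`.
  have double : ∀ k : ℕ, ∀ y ∈ C, 2 ^ k * τ ≤ dist y ((g ^ 2 ^ k) y) := by
    intro k
    induction k with
    | zero => intro y hy; simpa using hmin y hy
    | succ k ih =>
      intro y hy
      obtain ⟨m, hm⟩ := hX.exists_isBetween y ((g ^ 2 ^ k) y) (r := 1 / 2) (by norm_num)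
        (by norm_num)
      have h1 := ih m (hmid y hy _ (hpowC _ y hy) m hm)
      have hm' := hm.symm
      rw [show (1 : ℝ) - 1 / 2 = 1 / 2 by norm_num] at hm'
      have h2 := hX.dist_le_of_common_vertex (by norm_num) (by norm_num) hm'
        (hm.map (g ^ 2 ^ k).isometry)
      have e : g ^ 2 ^ (k + 1) = g ^ 2 ^ k * g ^ 2 ^ k := by rw [← pow_add, ← mul_two, pow_succ]
      rw [e, IsometryEquiv.mul_apply, pow_succ]
      linarith
  -- A deficit at `n` would persist up to a power of 2 beyond `n`.
  have hn : ∀ n : ℕ, dist x ((g ^ n) x) = n * τ := by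
    intro n
    refine le_antisymm (hτ ▸ g.dist_pow_le n x) ?_
    obtain ⟨k, hk⟩ : ∃ k : ℕ, 2 ^ k = n + (2 ^ k - n) := ⟨n, by
      have := n.lt_two_pow_self; omega⟩
    obtain ⟨j, hj⟩ : ∃ j, j = 2 ^ k - n := ⟨_, rfl⟩
    rw [← hj] at hk
    have h1 := double k x hx
    have h2 := dist_triangle x ((g ^ n) x) ((g ^ (n + j)) x)
    rw [pow_add, IsometryEquiv.mul_apply, (g ^ n).dist_eq] at h2
    have h3 := g.dist_pow_le j x
    rw [hk, pow_add, IsometryEquiv.mul_apply] at h1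
    have h4 : (2 : ℝ) ^ k = n + j := by exact_mod_cast hk
    rw [h4] at h1
    rw [← hτ] at h3
    linarith
  have hz : ∀ a b : ℤ, a ≤ b → dist ((g ^ a) x) ((g ^ b) x) = (b - a) * τ := by
    intro a b hab
    obtain ⟨n, rfl⟩ := Int.le.dest hab
    rw [zpow_add, IsometryEquiv.mul_apply, (g ^ a).dist_eq, zpow_natCast, hn]
    push_cast; ring
  obtain ⟨S, γ, hγ0, hγ1, hγ, -⟩ := hX.exists_geodesic x (g x)
  rw [← hτ] at hγ hγ1
  -- `c` concatenates the translates of a geodesic from `x` to `g x`; it is geodesic because the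
  -- orbit points have exact distances.
  obtain ⟨c, hc⟩ : ∃ c : ℝ → X, c = fun t => (g ^ ⌊t / τ⌋) (γ (t - ⌊t / τ⌋ * τ)) := ⟨_, rfl⟩
  have fl1 : ∀ t : ℝ, (⌊t / τ⌋ : ℝ) * τ ≤ t := fun t => by
    rw [← le_div_iff₀ hpos]; exact Int.floor_le _
  have fl2 : ∀ t : ℝ, t < (⌊t / τ⌋ + 1) * τ := fun t => by
    rw [← div_lt_iff₀ hpos]; exact Int.lt_floor_add_one _
  have mem : ∀ t : ℝ, t - ⌊t / τ⌋ * τ ∈ Set.Icc 0 τ := fun t =>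
    ⟨by linarith [fl1 t], by linarith [fl2 t]⟩
  have left : ∀ t, dist ((g ^ ⌊t / τ⌋) x) (c t) = t - ⌊t / τ⌋ * τ := by
    intro t
    simp only [hc]
    rw [(g ^ _).dist_eq]
    nth_rw 1 [← hγ0]
    rw [hγ 0 ⟨le_rfl, hpos.le⟩ _ (mem t), abs_sub_comm, sub_zero, abs_of_nonneg (mem t).1]
  have right : ∀ t, dist (c t) ((g ^ (⌊t / τ⌋ + 1)) x) = (⌊t / τ⌋ + 1) * τ - t := by
    intro t
    simp only [hc]
    rw [zpow_add_one, IsometryEquiv.mul_apply, (g ^ _).dist_eq, ← hγ1,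
      hγ _ (mem t) τ ⟨hpos.le, le_rfl⟩, abs_of_nonpos (by linarith [(mem t).2])]
    ring
  have ord : ∀ s t, s ≤ t → dist (c s) (c t) = t - s := by
    intro s t hst
    have hfl : ⌊s / τ⌋ ≤ ⌊t / τ⌋ := Int.floor_le_floor (by gcongr)
    refine le_antisymm ?_ ?_
    · rcases hfl.eq_or_lt with h | h
      · have ms := mem s
        rw [h] at ms
        simp only [hc, h]
        rw [(g ^ _).dist_eq, hγ _ ms _ (mem t), abs_of_nonpos (by linarith)]
        linarith
      · have h1 := hz _ _ (Int.add_one_le_of_lt h)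
        push_cast at h1
        linarith [right s, left t, dist_triangle4 (c s) ((g ^ (⌊s / τ⌋ + 1)) x)
          ((g ^ ⌊t / τ⌋) x) (c t)]
    · have h1 := hz ⌊s / τ⌋ (⌊t / τ⌋ + 1) (by linarith)
      push_cast at h1
      linarith [left s, right t, dist_triangle4 ((g ^ ⌊s / τ⌋) x) (c s) (c t)
          ((g ^ (⌊t / τ⌋ + 1)) x)]
  refine ⟨Set.range c, c, τ, Isometry.of_dist_eq fun s t => ?_, rfl, hpos, fun t => ?_⟩
  · rcases le_total s t with h | h
    · rw [ord s t h, Real.dist_eq, abs_of_nonpos (by linarith)]; ring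
    · rw [dist_comm, ord t s h, Real.dist_eq, abs_of_nonneg (by linarith)]
  · have e : ⌊(t + τ) / τ⌋ = ⌊t / τ⌋ + 1 := by
      rw [add_div, div_self hpos.ne', Int.floor_add_one]
    simp only [hc, e]
    rw [← IsometryEquiv.mul_apply, add_comm _ (1 : ℤ), zpow_one_add]
    push_cast
    ring_nf

/-- The orbits of `y` and `c 0` stay at constant distance, so `n * τ` is at most `n * dist y (g y)`
plus a constant; divide by `n`. -/
theorem le_displacement_of_isAxis {g : X ≃ᵢ X} {c : ℝ → X} {τ : ℝ} (hc : Isometry c)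
    (hτ : 0 < τ) (hg : ∀ t, g (c t) = c (t + τ)) (y : X) : τ ≤ dist y (g y) := by
  refine le_of_forall_pos_le_add fun ε hε => ?_
  obtain ⟨n, hn⟩ := exists_nat_gt (2 * dist y (c 0) / ε)
  have hn0 : (0 : ℝ) < n := lt_of_le_of_lt (by positivity) hn
  rw [div_lt_iff₀ hε] at hn
  have h1 := g.dist_pow_le n y
  have h2 := dist_triangle4 (c 0) y ((g ^ n) y) ((g ^ n) (c 0))
  have h3 : (g ^ n) (c 0) = c (n * τ) := by
    have := IsometryEquiv.zpow_translation hg n 0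
    rw [zpow_natCast] at this
    simpa using this
  rw [(g ^ n).dist_eq, h3, hc.dist_eq, Real.dist_eq, zero_sub, abs_neg,
    abs_of_pos (by positivity), dist_comm (c 0)] at h2
  have : n * τ ≤ n * (dist y (g y) + ε) := by linarith
  exact le_of_mul_le_mul_left this hn0

theorem IsAxis.isHyperbolicIsometry {g : X ≃ᵢ X} {l : Set X} (hl : IsAxis g l) :
    IsHyperbolicIsometry g := by
  obtain ⟨c, τ, hc, -, hτ, hg⟩ := hl
  have : dist (c 0) (g (c 0)) = τ := by
    rw [hg, hc.dist_eq, Real.dist_eq, zero_add, zero_sub, abs_neg, abs_of_pos hτ]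
  exact ⟨c 0, this ▸ hτ, fun y => this ▸ le_displacement_of_isAxis hc hτ hg y⟩

theorem IsCATZero.exists_isAxis_of_isHyperbolicIsometry (hX : IsCATZero X) {g : X ≃ᵢ X}
    (hg : IsHyperbolicIsometry g) : ∃ l, IsAxis g l := by
  obtain ⟨x, hx, hmin⟩ := hg
  exact hX.exists_isAxis (C := Set.univ) (fun _ _ => trivial) (fun _ _ _ _ _ _ => trivial)
    trivial hx fun y _ => hmin y

/-- Both translation lengths equal the minimal displacement, so the distance between the axes is
periodic in `t`. -/
theorem exists_dist_axes_le {g : X ≃ᵢ X} {c c' : ℝ → X} {τ τ' : ℝ} (hc : Isometry c)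
    (hc' : Isometry c') (hτ : 0 < τ) (hτ' : 0 < τ') (hg : ∀ t, g (c t) = c (t + τ))
    (hg' : ∀ t, g (c' t) = c' (t + τ')) : ∃ D, ∀ t, dist (c t) (c' t) ≤ D := by
  have h1 := le_displacement_of_isAxis hc hτ hg (c' 0)
  have h2 := le_displacement_of_isAxis hc' hτ' hg' (c 0)
  rw [hg', hc'.dist_eq, Real.dist_eq, zero_add, zero_sub, abs_neg, abs_of_pos hτ'] at h1
  rw [hg, hc.dist_eq, Real.dist_eq, zero_add, zero_sub, abs_neg, abs_of_pos hτ] at h2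
  obtain rfl : τ = τ' := le_antisymm h1 h2
  refine ⟨dist (c 0) (c' 0) + 2 * τ, fun t => ?_⟩
  obtain ⟨r, hr⟩ : ∃ r, r = t - ⌊t / τ⌋ * τ := ⟨_, rfl⟩
  have fl1 : (⌊t / τ⌋ : ℝ) * τ ≤ t := by
    rw [← le_div_iff₀ hτ]; exact Int.floor_le _
  have fl2 : t < (⌊t / τ⌋ + 1) * τ := by
    rw [← div_lt_iff₀ hτ]; exact Int.lt_floor_add_one _
  have e : t = r + ⌊t / τ⌋ * τ := by linarith
  have e1 := IsometryEquiv.zpow_translation hg ⌊t / τ⌋ r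
  have e2 := IsometryEquiv.zpow_translation hg' ⌊t / τ⌋ r
  rw [← e] at e1 e2
  rw [← e1, ← e2, IsometryEquiv.dist_eq]
  have h3 : dist (c r) (c 0) ≤ τ := by
    rw [hc.dist_eq, Real.dist_eq, sub_zero, abs_of_nonneg (by linarith)]; linarith
  have h4 : dist (c' 0) (c' r) ≤ τ := by
    rw [hc'.dist_eq, Real.dist_eq, zero_sub, abs_neg, abs_of_nonneg (by linarith)]; linarith
  linarith [dist_triangle4 (c r) (c 0) (c' 0) (c' r)]

/-- If one axis of an isometry bounds a half-flat, then so does every other axis. -/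
theorem BoundsHalfFlat.of_isAxis [ProperSpace X] (hX : IsCATZero X) {g : X ≃ᵢ X} {l l' : Set X}
    (hl : IsAxis g l) (hl' : IsAxis g l') (h : BoundsHalfFlat l) : BoundsHalfFlat l' := by
  obtain ⟨c, τ, hc, rfl, hτ, hg⟩ := hl
  obtain ⟨c', τ', hc', rfl, hτ', hg'⟩ := hl'
  obtain ⟨D, hD⟩ := exists_dist_axes_le hc hc' hτ hτ' hg hg'
  obtain ⟨F, hF0, hF⟩ := (boundsHalfFlat_range_iff hc).1 h
  have hw : ∀ (n : ℕ) t, dist (F 0 n) (c t) ^ 2 = t ^ 2 + n ^ 2 := by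
    intro n t
    rw [← hF0, hF _ _ _ _ (Nat.cast_nonneg n) le_rfl]; ring
  have hw0 : ∀ n : ℕ, dist (F 0 n) (c 0) = n := by
    intro n
    rw [← sq_eq_sq₀ dist_nonneg (Nat.cast_nonneg n), hw]; ring
  have hat : (hyperfilter ℕ : Filter ℕ) ≤ atTop := Nat.hyperfilter_le_atTop
  have near : ∀ n t, |dist (F 0 n) (c' t) - dist (F 0 n) (c t)| ≤ D := by
    intro n t
    rw [abs_le]
    constructor <;> linarith [hD t, dist_triangle (F 0 n) (c t) (c' t),
      dist_triangle_right (F 0 n) (c t) (c' t)]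
  -- Seen from far up the perpendicular at `c 0`, the Busemann function is constant along `c`, hence
  -- bounded along `c'`.
  refine boundsHalfFlat_of_eventually_le hX hc' (hyperfilter ℕ) (fun n : ℕ => F 0 n) (σ := 0)
    (K := 2 * D + 1) (by norm_num) ?_ fun t => ?_
  · refine tendsto_atTop_mono (f := fun n : ℕ => (n : ℝ) + -D) (fun n => ?_)
      ((tendsto_atTop_add_const_right _ _ tendsto_natCast_atTop_atTop).mono_left hat)
    linarith [(abs_le.1 (near n 0)).1, hw0 n]
  · filter_upwards [hat (tendsto_natCast_atTop_atTop.eventually_ge_atTop (t ^ 2))] with n hn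
    have h1 : (n : ℝ) ≤ dist (F 0 n) (c t) := by
      refine le_of_sq_le_sq ?_ dist_nonneg
      rw [hw]; nlinarith
    have h2 : dist (F 0 n) (c t) ≤ n + 1 := by
      refine le_of_sq_le_sq ?_ (by positivity)
      rw [hw]; nlinarith
    have h3 := near n t
    have h4 := near n 0
    rw [hw0] at h4
    rw [abs_le] at h3 h4 ⊢
    constructor <;> linarith

/-- A ball of radius `B / 2` centred at height `B` in the half-flat projects onto a set containing
two points at distance exactly `B`. -/
theorem not_boundsHalfFlat_of_isContracting {c : ℝ → X} (hc : Isometry c) {B : ℝ} (hB : 0 < B)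
    (h : IsContracting B (Set.range c)) : ¬ BoundsHalfFlat (Set.range c) := by
  intro hF
  obtain ⟨F, hF0, hF⟩ := (boundsHalfFlat_range_iff hc).1 hF
  have hd : ∀ u t, dist (F u B) (c t) ^ 2 = (u - t) ^ 2 + B ^ 2 := by
    intro u t
    rw [← hF0, hF _ _ _ _ hB.le le_rfl]; ring
  have hlt := h (Metric.closedBall (F 0 B) (B / 2)) ⟨_, _, Or.inr rfl⟩ (by
    rw [Set.disjoint_left]
    rintro _ hx ⟨t, rfl⟩
    rw [Metric.mem_closedBall'] at hx
    have := pow_le_pow_left₀ dist_nonneg hx 2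
    rw [hd] at this
    nlinarith)
  have mem : ∀ u, |u| = B / 2 →
      c u ∈ ⋃ x ∈ Metric.closedBall (F 0 B) (B / 2), nearestPoints (Set.range c) x := by
    intro u hu
    simp only [Set.mem_iUnion]
    refine ⟨F u B, ?_, ⟨u, rfl⟩, ?_⟩
    · rw [Metric.mem_closedBall]
      refine le_of_sq_le_sq ?_ (by linarith)
      rw [hF _ _ _ _ hB.le hB.le, ← hu, sq_abs]
      linarith
    · rintro _ ⟨t, rfl⟩
      refine le_of_sq_le_sq ?_ dist_nonneg
      rw [hd, hd]
      nlinarith [sq_nonneg (u - t)]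
  have h1 := Metric.edist_le_ediam_of_mem (mem (B / 2) (abs_of_pos (by linarith)))
    (mem (-(B / 2)) (by rw [abs_neg, abs_of_pos (by linarith)]))
  rw [edist_dist, hc.dist_eq, Real.dist_eq, show B / 2 - -(B / 2) = B by ring, abs_of_pos hB] at h1
  exact absurd hlt (not_lt.2 h1)

theorem isCompact_image_of_isometricOn {c : ℝ → X} {a b : ℝ}
    (hc : ∀ s ∈ Set.Icc a b, ∀ t ∈ Set.Icc a b, dist (c s) (c t) = |s - t|) :
    IsCompact (c '' Set.Icc a b) := by
  refine isCompact_Icc.image_of_continuousOn ?_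
  have : LipschitzOnWith 1 c (Set.Icc a b) :=
    LipschitzOnWith.of_dist_le_mul fun s hs t ht => by
      rw [hc s hs t ht, Real.dist_eq]; simp
  exact this.continuousOn

/-- Long geodesics fellow-travelling the boundary line of a half-flat are not contracting. -/
theorem not_isContracting_of_boundsHalfFlat {c : ℝ → X} (hc : Isometry c)
    (hflat : BoundsHalfFlat (Set.range c)) {R B : ℝ} (hR : 0 ≤ R) (hB : 0 < B) {γ : ℝ → X}
    {T : ℝ} (hT : 100 * (R + B) ≤ T)
    (hγ : ∀ s ∈ Set.Icc 0 T, ∀ t ∈ Set.Icc 0 T, dist (γ s) (γ t) = |s - t|)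
    (hγc : ∀ t ∈ Set.Icc 0 T, dist (γ t) (c t) ≤ R) : ¬ IsContracting B (γ '' Set.Icc 0 T) := by
  intro h
  obtain ⟨F, hF0, hF⟩ := (boundsHalfFlat_range_iff hc).1 hflat
  -- At height `H` the error `R` moves a foot by at most `H / 4`, as `4 * R * H + 4 * R ^ 2` is
  -- below `H ^ 2 / 16`. Feet of points `H` apart are then at least `H / 2` apart.
  obtain ⟨H, hH⟩ : ∃ H, H = 100 * (R + B) := ⟨_, rfl⟩
  rw [← hH] at hT
  have hH0 : 0 < H := by linarith
  have hd : ∀ u t, dist (F u H) (c t) ^ 2 = (u - t) ^ 2 + H ^ 2 := by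
    intro u t
    rw [← hF0, hF _ _ _ _ hH0.le le_rfl]; ring
  have hlt := h (Metric.closedBall (F (T / 2) H) (H / 2)) ⟨_, _, Or.inr rfl⟩ (by
    rw [Set.disjoint_left]
    rintro _ hx ⟨t, ht, rfl⟩
    rw [Metric.mem_closedBall'] at hx
    have h1 : H ≤ dist (F (T / 2) H) (c t) := by
      refine le_of_sq_le_sq ?_ dist_nonneg
      rw [hd]; nlinarith [sq_nonneg (T / 2 - t)]
    linarith [dist_triangle (F (T / 2) H) (γ t) (c t), hγc t ht])
  have mem : ∀ u, |u - T / 2| = H / 2 → ∃ t ∈ Set.Icc 0 T, |u - t| ≤ H / 4 ∧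
      γ t ∈ ⋃ x ∈ Metric.closedBall (F (T / 2) H) (H / 2), nearestPoints (γ '' Set.Icc 0 T) x := by
    intro u hu
    have hu' := abs_le.1 hu.le
    have huT : u ∈ Set.Icc 0 T := ⟨by linarith, by linarith⟩
    obtain ⟨_, ⟨t, ht, rfl⟩, htmin⟩ :=
      (isCompact_image_of_isometricOn hγ).exists_infDist_eq_dist ⟨_, u, huT, rfl⟩ (F u H)
    have hmin : ∀ y ∈ γ '' Set.Icc 0 T, dist (F u H) (γ t) ≤ dist (F u H) y := fun y hy => by
      rw [← htmin]; exact Metric.infDist_le_dist_of_mem hy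
    refine ⟨t, ht, ?_, ?_⟩
    · have h1 := hmin _ ⟨u, huT, rfl⟩
      have h2 : dist (F u H) (c u) = H := by
        rw [← sq_eq_sq₀ dist_nonneg hH0.le, hd]; ring
      have h3 : dist (F u H) (c t) ≤ H + 2 * R := by
        linarith [dist_triangle (F u H) (γ t) (c t), hγc t ht,
          dist_triangle_right (F u H) (γ u) (c u), hγc u huT]
      have h4 := pow_le_pow_left₀ dist_nonneg h3 2
      rw [hd] at h4
      refine abs_le_of_sq_le_sq ?_ (by linarith)
      nlinarith
    · simp only [Set.mem_iUnion]
      refine ⟨F u H, ?_, ⟨t, ht, rfl⟩, hmin⟩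
      rw [Metric.mem_closedBall]
      refine le_of_sq_le_sq ?_ (by linarith)
      rw [hF _ _ _ _ hH0.le hH0.le, ← hu, sq_abs]
      linarith
  obtain ⟨t₁, ht₁, hu₁, hm₁⟩ := mem (T / 2 + H / 2) (by
    rw [add_sub_cancel_left, abs_of_pos (by linarith)])
  obtain ⟨t₂, ht₂, hu₂, hm₂⟩ := mem (T / 2 - H / 2) (by
    rw [sub_sub_cancel_left, abs_neg, abs_of_pos (by linarith)])
  rw [abs_le] at hu₁ hu₂
  have h1 := Metric.edist_le_ediam_of_mem hm₁ hm₂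
  rw [edist_dist, hγ _ ht₁ _ ht₂, abs_of_nonneg (by linarith)] at h1
  refine absurd hlt (not_lt.2 (le_trans (ENNReal.ofReal_le_ofReal ?_) h1))
  linarith

end Axes

/-! ### Equivalence of the two notions of rank 1 -/

section RankOne

variable {X : Type*} [MetricSpace X]

theorem IsContracting.mono {B B' : ℝ} {A : Set X} (h : IsContracting B A) (hB : B ≤ B') :
    IsContracting B' A :=
  fun K hK hd => (h K hK hd).trans_le (ENNReal.ofReal_le_ofReal hB)

/-- The segment `[x, gⁿ x]` fellow-travels an axis of `g`. -/
theorem IsCATZero.dist_segment_axis_le (hX : IsCATZero X) {g : X ≃ᵢ X} {c : ℝ → X} {τ : ℝ}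
    (hc : Isometry c) (hτ : 0 < τ) (hg : ∀ t, g (c t) = c (t + τ)) (x : X) (n : ℕ) :
    |n * τ - dist x (g^[n] x)| ≤ 2 * dist x (c 0) ∧
    ∀ γ : ℝ → X, γ 0 = x → γ (dist x (g^[n] x)) = g^[n] x →
      (∀ s ∈ Set.Icc 0 (dist x (g^[n] x)), ∀ t ∈ Set.Icc 0 (dist x (g^[n] x)),
        dist (γ s) (γ t) = |s - t|) →
      ∀ t ∈ Set.Icc 0 (dist x (g^[n] x)), dist (γ t) (c t) ≤ 3 * dist x (c 0) := by
  have hn : dist (g^[n] x) (c (n * τ)) = dist x (c 0) := by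
    have h1 := IsometryEquiv.zpow_translation hg n 0
    rw [zpow_natCast] at h1
    rw [← g.pow_apply_eq_iterate, ← (g ^ n).dist_eq x, h1]
    simp
  have hnτ : dist (c 0) (c (n * τ)) = n * τ := by
    rw [hc.dist_eq, Real.dist_eq, zero_sub, abs_neg, abs_of_nonneg (by positivity)]
  have hdiff : |n * τ - dist x (g^[n] x)| ≤ 2 * dist x (c 0) := by
    have h1 := dist_triangle4 (c 0) x (g^[n] x) (c (n * τ))
    have h2 := dist_triangle4 x (c 0) (c (n * τ)) (g^[n] x)
    rw [dist_comm (c 0) x] at h1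
    rw [dist_comm (c (n * τ)) (g^[n] x)] at h2
    rw [abs_le]
    constructor <;> linarith
  refine ⟨hdiff, fun γ h0 h1 hγ t ht => ?_⟩
  generalize hy : g^[n] x = y at *
  rcases (dist_nonneg (x := x) (y := y)).eq_or_lt with hA | hA
  · obtain rfl : t = 0 := le_antisymm (hA ▸ ht.2) ht.1
    rw [h0]
    linarith [dist_nonneg (x := x) (y := c 0)]
  · obtain ⟨r, hr⟩ : ∃ r, r = t / dist x y := ⟨_, rfl⟩
    have hrt : r * dist x y = t := by rw [hr]; field_simp
    have hr0 : 0 ≤ r := hr ▸ div_nonneg ht.1 hA.le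
    have hr1 : r ≤ 1 := by rw [hr]; exact div_le_one_of_le₀ ht.2 hA.le
    have b1 := isBetween_of_isometricOn hA.le hγ hr0 hr1
    rw [h0, h1, sub_zero, zero_add, hrt] at b1
    have b2 := isBetween_of_isometricOn (c := c) (a := 0) (b := n * τ) (by positivity)
      (fun s _ t _ => hc.dist_eq s t) hr0 hr1
    rw [sub_zero, zero_add] at b2
    have q := hX.dist_quadrilateral hr0 hr1 b1 b2
    rw [hn] at q
    -- The two lengths differ by at most `2 * dist x (c 0)`, so reparametrizing by arc length costs
    -- no more than that.
    have e : dist (c (r * (n * τ))) (c t) ≤ 2 * dist x (c 0) := by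
      rw [hc.dist_eq, Real.dist_eq, ← hrt, ← mul_sub, abs_mul, abs_of_nonneg hr0]
      exact (mul_le_of_le_one_left (abs_nonneg _) hr1).trans hdiff
    linarith [dist_triangle (γ t) (c (r * (n * τ))) (c t)]

theorem IsBallmannBrinRankOne.isRankOne [ProperSpace X] (hX : IsCATZero X) {g : X ≃ᵢ X}
    (h : IsBallmannBrinRankOne g) (x₀ : X) : IsRankOne g x₀ := by
  obtain ⟨-, l, ⟨c, τ, hc, rfl, hτ, hg⟩, hflat⟩ := h
  obtain ⟨K, hK⟩ : ∃ K, K = dist x₀ (c 0) := ⟨_, rfl⟩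
  have hK0 : 0 ≤ K := hK ▸ dist_nonneg
  have fellow := hX.dist_segment_axis_le hc hτ hg x₀
  rw [← hK] at fellow
  have horb : ∀ k : ℕ, dist (g^[k] x₀) (c (k * τ)) = K := by
    intro k
    have h1 := IsometryEquiv.zpow_translation hg k 0
    rw [zpow_natCast] at h1
    rw [← g.pow_apply_eq_iterate, hK, ← (g ^ k).dist_eq x₀, h1]
    simp
  obtain ⟨B, hB0, hB⟩ := exists_uniform_contracting hX hc hτ hg hflat (3 * K)
  -- `6 * K + τ` is `3 * K` from segment to axis, `τ + 2 * K` along the axis and `K` to the orbit;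
  -- the 1 is for the open neighbourhood.
  refine ⟨?_, max B (6 * K + τ + 1), lt_max_of_lt_left hB0, fun n _ => ?_⟩
  · refine tendsto_atTop_mono (f := fun n : ℕ => (n : ℝ) * τ + -(2 * K)) (fun n => ?_)
      (tendsto_atTop_add_const_right _ _ (tendsto_natCast_atTop_atTop.atTop_mul_const hτ))
    have := (abs_le.1 (fellow n).1).2
    rw [dist_comm]
    linarith
  obtain ⟨S, hS⟩ := hX.exists_geodesic x₀ (g^[n] x₀)
  have hS' := hS
  obtain ⟨γ, h0, h1, hγ, rfl⟩ := hS'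
  have hA := abs_le.1 (fellow n).1
  have hf := (fellow n).2 γ h0 h1 hγ
  obtain ⟨A, hAd⟩ : ∃ A, A = dist x₀ (g^[n] x₀) := ⟨_, rfl⟩
  rw [← hAd] at hA hf hγ hS
  have hA0 : 0 ≤ A := hAd ▸ dist_nonneg
  refine ⟨⟨_, hS, ?_, ?_⟩, _, hS, ?_⟩
  · rintro _ ⟨t, ht, rfl⟩
    rw [Metric.mem_thickening_iff]
    obtain ⟨k, hkn, hk⟩ : ∃ k ≤ n, |t - k * τ| ≤ τ + 2 * K := by
      rcases le_total t (n * τ) with h | h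
      · refine ⟨⌊t / τ⌋₊, Nat.floor_le_of_le (by rwa [div_le_iff₀ hτ]), ?_⟩
        have e1 : (⌊t / τ⌋₊ : ℝ) * τ ≤ t := by
          rw [← le_div_iff₀ hτ]; exact Nat.floor_le (div_nonneg ht.1 hτ.le)
        have e2 : t < (⌊t / τ⌋₊ + 1) * τ := by
          rw [← div_lt_iff₀ hτ]; exact Nat.lt_floor_add_one _
        rw [abs_of_nonneg (by linarith)]
        linarith
      · refine ⟨n, le_rfl, ?_⟩
        rw [abs_of_nonneg (by linarith)]
        linarith [ht.2]
    refine ⟨g^[k] x₀, ⟨k, hkn, rfl⟩, lt_max_of_lt_right ?_⟩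
    have h2 := dist_triangle4 (γ t) (c t) (c (k * τ)) (g^[k] x₀)
    rw [hc.dist_eq, Real.dist_eq, dist_comm (c (k * τ)), horb] at h2
    linarith [hf t ht]
  · rintro _ ⟨k, hkn, rfl⟩
    rw [Metric.mem_thickening_iff]
    have hkn' : (k : ℝ) * τ ≤ n * τ := by gcongr
    have hk0 : 0 ≤ (k : ℝ) * τ := by positivity
    obtain ⟨t, ht, htk⟩ : ∃ t ∈ Set.Icc 0 A, |k * τ - t| ≤ 2 * K := by
      rcases le_total ((k : ℝ) * τ) A with h | h
      · exact ⟨k * τ, ⟨hk0, h⟩, by simpa using hK0⟩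
      · refine ⟨A, ⟨hA0, le_rfl⟩, ?_⟩
        rw [abs_of_nonneg (by linarith)]
        linarith
    refine ⟨γ t, ⟨t, ht, rfl⟩, lt_max_of_lt_right ?_⟩
    have h2 := dist_triangle4 (g^[k] x₀) (c (k * τ)) (c t) (γ t)
    rw [hc.dist_eq, Real.dist_eq, dist_comm (c t), horb] at h2
    linarith [hf t ht]
  · exact (hB γ _ (convex_Icc _ _) (isCompact_image_of_isometricOn hγ).isClosed hγ hf).mono
      (le_max_left _ _)

/-- If the segments `[x₀, gⁿ x₀]` stay uniformly close to the orbit of `x₀` and the orbit is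
unbounded, then `g` has an axis. -/
theorem IsCATZero.exists_isAxis_of_hausdorffEquivalent [ProperSpace X] (hX : IsCATZero X)
    {g : X ≃ᵢ X} {x₀ : X} (htend : Tendsto (fun n : ℕ => dist (g^[n] x₀) x₀) atTop atTop)
    {B : ℝ} (hB : 0 < B) {S : ℕ → Set X}
    (hS : ∀ n, 0 < n → IsGeodesicSegment x₀ (g^[n] x₀) (S n))
    (hSB : ∀ n, 0 < n → HausdorffEquivalent B (S n) {y | ∃ k ≤ n, y = g^[k] x₀}) :
    ∃ l, IsAxis g l := by
  -- Requiring both `k` and `m` to be large keeps away from the ends of the segments and makes `C`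
  -- invariant under `g` and its inverse. The slack `ε` makes it closed.
  set C : Set X := {y | ∀ ε > 0, ∃ N : ℕ, ∀ k ≥ N, ∀ m ≥ N,
    ∃ p ∈ S (k + m), dist (g^[k] y) p ≤ B + ε} with hC
  have hiso : ∀ k, Isometry g^[k] := fun k =>
    (funext (g.pow_apply_eq_iterate k) : ⇑(g ^ k) = g^[k]) ▸ (g ^ k).isometry
  have hx₀ : x₀ ∈ C := by
    intro ε hε
    refine ⟨1, fun k hk m hm => ?_⟩
    obtain ⟨p, hp, hd⟩ := Metric.mem_thickening_iff.1
      ((hSB (k + m) (by omega)).2 ⟨k, by omega, rfl⟩)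
    exact ⟨p, hp, by linarith⟩
  have hgC : ∀ y ∈ C, g y ∈ C := by
    intro y hy ε hε
    obtain ⟨N, hN⟩ := hy ε hε
    refine ⟨N + 1, fun k hk m hm => ?_⟩
    have := hN (k + 1) (by omega) (m - 1) (by omega)
    rwa [show k + 1 + (m - 1) = k + m by omega, Function.iterate_succ_apply] at this
  have hgC' : ∀ y ∈ C, g.symm y ∈ C := by
    intro y hy ε hε
    obtain ⟨N, hN⟩ := hy ε hε
    refine ⟨N + 1, fun k hk m hm => ?_⟩
    obtain ⟨j, rfl⟩ : ∃ j, k = j + 1 := ⟨k - 1, by omega⟩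
    have := hN j (by omega) (m + 1) (by omega)
    rw [Function.iterate_succ_apply, g.apply_symm_apply]
    rwa [show j + (m + 1) = j + 1 + m by omega] at this
  have hmid : ∀ a ∈ C, ∀ b ∈ C, ∀ m, IsBetween a b (1 / 2) m → m ∈ C := by
    intro a ha b hb m hm ε hε
    obtain ⟨N, hN⟩ := ha ε hε
    obtain ⟨N', hN'⟩ := hb ε hε
    refine ⟨max (max N N') 1, fun k hk i hi => ?_⟩
    simp only [ge_iff_le, max_le_iff] at hk hi
    obtain ⟨p, hp, hpd⟩ := hN k hk.1.1 i hi.1.1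
    obtain ⟨q, hq, hqd⟩ := hN' k hk.1.2 i hi.1.2
    obtain ⟨γ, -, -, hγ, hγS⟩ := hS (k + i) (by omega)
    rw [← hγS] at hp hq ⊢
    obtain ⟨s, hs, rfl⟩ := hp
    obtain ⟨t, ht, rfl⟩ := hq
    have hst : (s + t) / 2 ∈ Set.Icc 0 (dist x₀ (g^[k + i] x₀)) :=
      ⟨by linarith [hs.1, ht.1], by linarith [hs.2, ht.2]⟩
    have hb' : IsBetween (γ s) (γ t) (1 / 2) (γ ((s + t) / 2)) := by
      refine ⟨?_, ?_⟩
      · rw [hγ s hs _ hst, hγ s hs t ht, show s - (s + t) / 2 = (1 / 2) * (s - t) by ring, abs_mul]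
        norm_num
      · rw [hγ _ hst t ht, hγ s hs t ht, show (s + t) / 2 - t = (1 / 2) * (s - t) by ring, abs_mul]
        norm_num
    refine ⟨_, ⟨_, hst, rfl⟩, ?_⟩
    have := hX.dist_quadrilateral (by norm_num) (by norm_num) (hm.map (hiso k)) hb'
    linarith
  have hclosed : IsClosed C := by
    refine isClosed_of_closure_subset fun y hy ε hε => ?_
    obtain ⟨y', hy', hyy'⟩ := Metric.mem_closure_iff.1 hy (ε / 2) (by linarith)
    obtain ⟨N, hN⟩ := hy' (ε / 2) (by linarith)
    refine ⟨N, fun k hk m hm => ?_⟩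
    obtain ⟨p, hp, hpd⟩ := hN k hk m hm
    refine ⟨p, hp, ?_⟩
    have := dist_triangle (g^[k] y) (g^[k] y') p
    rw [(hiso k).dist_eq] at this
    linarith
  have hiter : ∀ n, ∀ y ∈ C, g^[n] y ∈ C ∧ g.symm^[n] y ∈ C := by
    intro n
    induction n with
    | zero => exact fun y hy => ⟨hy, hy⟩
    | succ n ih =>
      intro y hy
      exact ⟨(ih _ (hgC y hy)).1, (ih _ (hgC' y hy)).2⟩
  have hdisp : ∀ n y, dist (g^[n] y) (g (g^[n] y)) = dist y (g y) := by
    intro n y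
    rw [← Function.iterate_succ_apply' g n y, Function.iterate_succ_apply, (hiso n).dist_eq]
  have hinv : ∀ n y, g^[n] (g.symm^[n] y) = y := fun n y =>
    Function.LeftInverse.iterate (fun y => g.apply_symm_apply y) n y
  have hcpt : IsCompact (C ∩ Metric.closedBall x₀ (2 * B + 1)) :=
    (isCompact_closedBall _ _).inter_left hclosed
  obtain ⟨x, ⟨hxC, -⟩, hxmin⟩ := hcpt.exists_isMinOn
    ⟨x₀, hx₀, Metric.mem_closedBall_self (by linarith)⟩
    (f := fun y => dist y (g y)) (continuous_id.dist g.continuous).continuousOn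
  -- An iterate of `y` is near some segment, hence near some `g^[j] x₀`. Undoing `j` steps lands in
  -- the compact piece with the same displacement.
  have hmin : ∀ y ∈ C, dist x (g x) ≤ dist y (g y) := by
    intro y hy
    obtain ⟨N, hN⟩ := hy 1 one_pos
    obtain ⟨p, hp, hpd⟩ := hN (N + 1) (by omega) (N + 1) (by omega)
    obtain ⟨_, ⟨j, -, rfl⟩, hpj⟩ := Metric.mem_thickening_iff.1
      ((hSB (N + 1 + (N + 1)) (by omega)).1 hp)
    set z := g.symm^[j] (g^[N + 1] y) with hz
    have hzj : g^[j] z = g^[N + 1] y := hinv j _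
    have hzC : z ∈ C := (hiter j _ (hiter (N + 1) y hy).1).2
    have hzx : dist z x₀ ≤ 2 * B + 1 := by
      rw [← (hiso j).dist_eq, hzj]
      linarith [dist_triangle (g^[N + 1] y) p (g^[j] x₀)]
    have h1 : dist x (g x) ≤ dist z (g z) := hxmin ⟨hzC, Metric.mem_closedBall.2 hzx⟩
    rwa [← hdisp j z, hzj, hdisp] at h1
  have hpos : 0 < dist x (g x) := by
    rw [dist_pos]
    intro hfix
    have hfixn : ∀ n, g^[n] x = x := fun n => Function.iterate_fixed hfix.symm n
    obtain ⟨n, hn⟩ := (htend.eventually_gt_atTop (2 * dist x₀ x)).exists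
    have h1 := dist_triangle_right (g^[n] x₀) x₀ x
    have h2 := (hiso n).dist_eq x₀ x
    rw [hfixn] at h2
    linarith
  exact hX.exists_isAxis hgC hmid hxC hpos hmin

theorem IsRankOne.isBallmannBrinRankOne [ProperSpace X] (hX : IsCATZero X) {g : X ≃ᵢ X} {x₀ : X}
    (h : IsRankOne g x₀) : IsBallmannBrinRankOne g := by
  obtain ⟨htend, B, hB, h⟩ := h
  have : ∀ n, ∃ S, 0 < n → IsGeodesicSegment x₀ (g^[n] x₀) S ∧
      HausdorffEquivalent B S {y | ∃ k ≤ n, y = g^[k] x₀} := by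
    intro n
    by_cases hn : 0 < n
    · obtain ⟨⟨S, hS⟩, -⟩ := h n hn
      exact ⟨S, fun _ => hS⟩
    · exact ⟨∅, fun hn' => absurd hn' hn⟩
  choose S hS using this
  obtain ⟨l, hl⟩ := hX.exists_isAxis_of_hausdorffEquivalent htend hB (fun n hn => (hS n hn).1)
    fun n hn => (hS n hn).2
  refine ⟨hl.isHyperbolicIsometry, l, hl, fun hflat => ?_⟩
  obtain ⟨c, τ, hc, rfl, hτ, hg⟩ := hl
  -- `3 * dist x₀ (c 0)` is the fellow-travelling constant; beyond this length a half-flat excludes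
  -- contraction.
  obtain ⟨n, hn, hn0⟩ := ((htend.eventually_ge_atTop (100 * (3 * dist x₀ (c 0) + B))).and
    (eventually_gt_atTop 0)).exists
  obtain ⟨-, _, ⟨γ, h0, h1, hγ, rfl⟩, hcon⟩ := h n hn0
  rw [dist_comm (g^[n] x₀)] at hn
  exact not_isContracting_of_boundsHalfFlat hc hflat (by positivity) hB hn hγ
    ((hX.dist_segment_axis_le hc hτ hg x₀ n).2 γ h0 h1 hγ) hcon

end RankOne

theorem mainTheorem7 {X : Type*} [MetricSpace X] [ProperSpace X] (hX : IsCATZero X)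
    (g : X ≃ᵢ X) :
    (∀ l : Set X, IsHyperbolicIsometry g → IsAxis g l →
      ((∃ B : ℝ, 0 < B ∧ IsContracting B l) ↔ ¬ BoundsHalfFlat l)) ∧
    (IsBallmannBrinRankOne g ↔
      IsHyperbolicIsometry g ∧ ∀ l : Set X, IsAxis g l → ¬ BoundsHalfFlat l) ∧
    (∀ x₀ : X, IsRankOne g x₀ ↔ IsBallmannBrinRankOne g) := by
  refine ⟨?_, ⟨?_, ?_⟩, fun x₀ => ⟨fun h => h.isBallmannBrinRankOne hX, fun h => h.isRankOne hX x₀⟩⟩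
  · rintro l - ⟨c, τ, hc, rfl, hτ, hg⟩
    refine ⟨fun ⟨B, hB, h⟩ => not_boundsHalfFlat_of_isContracting hc hB h, fun hflat => ?_⟩
    obtain ⟨B, hB, h⟩ := exists_uniform_contracting hX hc hτ hg hflat 0
    refine ⟨B, hB, ?_⟩
    rw [← Set.image_univ]
    refine h c Set.univ convex_univ ?_ (fun s _ t _ => hc.dist_eq s t) fun t _ => (dist_self _).le
    rw [Set.image_univ]
    exact hc.isClosedEmbedding.isClosed_range
  · rintro ⟨hg, l, hl, hflat⟩
    exact ⟨hg, fun l' hl' h => hflat (h.of_isAxis hX hl' hl)⟩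
  · rintro ⟨hg, h⟩
    obtain ⟨l, hl⟩ := hX.exists_isAxis_of_isHyperbolicIsometry hg
    exact ⟨hg, l, hl, h l hl⟩
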